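/- Let $p$ be a prime, $d\ge 2$, and let $F$ be a free metabelian pro-$p$ group on generators $g_1,\dots,g_d$, that is, a metabelian pro-$p$ group such that every map from $\{g_1,\dots,g_d\}$ to a metabelian pro-$p$ group $H$ extends uniquely to a continuous homomorphism $F\to H$. Let $A=F'$ be the (closed) derived subgroup of $F$, $X=F/A$, and $x_i=g_iA\in X$. Then $A$ is abelian; written additively, with $X$ acting by conjugation, $a\cdot(gA)=g^{-1}ag$, it is a module over the completed group algebra $\mathbb{Z}_p[[X]]=\varprojlim_N \mathbb{Z}_p[X/N]$ ($N$ running over the open subgroups of $X$), the action being the one induced on $A=\varprojlim_V A/(A\cap V)$, $V$ running over the open normal subgroups of $F$. For $1\le j\le d$ let $X_j=\overline{\langle x_1,\dots,x_j\rangle}\le X$ and $R_j=\mathbb{Z}_p[[X_j]]$, which acts on $A$ through the map $R_j\to\mathbb{Z}_p[[X]]$ induced by the inclusion $X_j\le X$. Put $u_{ij}=[g_i,g_j]=g_i^{-1}g_j^{-1}g_ig_j$. Then for each $a\in A$ there is exactly one family $(r_{ij})_{1\le i<j\le d}$ with $r_{ij}\in R_j$ for all $i<j$ and $$a=\sum_{1\le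 i<j\le d}u_{ij}r_{ij}.$$ -/

import Mathlib

universe u

open scoped commutatorElement

noncomputable section

/-! ### Completed group algebras -/

/-- The canonical map `k[G ⧸ N] → k[G ⧸ M]` of group algebras, for normal subgroups `N ≤ M`. -/
def quotientAlgebraMap (k : Type*) {G : Type*} [CommRing k] [Group G] (N M : Subgroup G)
    [N.Normal] [M.Normal] (h : N ≤ M) : MonoidAlgebra k (G ⧸ N) →ₐ[k] MonoidAlgebra k (G ⧸ M) :=
  MonoidAlgebra.mapDomainAlgHom k k (QuotientGroup.map N M (MonoidHom.id G) h)

theorem quotientAlgebraMap_single {k G : Type*} [CommRing k] [Group G] (N M : Subgroup G)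
    [N.Normal] [M.Normal] (h : N ≤ M) (x : G) (c : k) :
    quotientAlgebraMap k N M h (MonoidAlgebra.single (x : G ⧸ N) c) =
      MonoidAlgebra.single (x : G ⧸ M) c := by
  simp only [quotientAlgebraMap, MonoidAlgebra.mapDomainAlgHom_apply, MonoidAlgebra.mapDomain_single]
  rfl

/-- The completed group algebra `k[[G]] = lim k[G ⧸ N]`, the inverse limit over all open normal
subgroups `N` of `G`, realised as the algebra of compatible families. -/
def CompletedGroupAlgebra (k G : Type*) [CommRing k] [Group G] [TopologicalSpace G] :
    Subalgebra k (∀ N : OpenNormalSubgroup G, MonoidAlgebra k (G ⧸ N.toSubgroup)) where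
  carrier := {r | ∀ (N M : OpenNormalSubgroup G) (h : N.toSubgroup ≤ M.toSubgroup),
    quotientAlgebraMap k N.toSubgroup M.toSubgroup h (r N) = r M}
  mul_mem' {r s} hr hs N M h := by simp [hr N M h, hs N M h]
  add_mem' {r s} hr hs N M h := by simp [hr N M h, hs N M h]
  algebraMap_mem' c N M h := by
    rw [Pi.algebraMap_apply, Pi.algebraMap_apply]
    exact AlgHom.commutes _ c

/-- The preimage of an open normal subgroup under a continuous homomorphism. -/
def OpenNormalSubgroup.preimage {G H : Type*} [Group G] [TopologicalSpace G] [Group H]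
    [TopologicalSpace H] (f : G →ₜ* H) (N : OpenNormalSubgroup H) : OpenNormalSubgroup G where
  toSubgroup := N.toSubgroup.comap (f : G →* H)
  isOpen' := N.isOpen'.preimage f.continuous_toFun
  isNormal' := inferInstance

/-- The algebra homomorphism `k[[G]] → k[[H]]` induced by a continuous homomorphism `G → H`. -/
def CompletedGroupAlgebra.map (k : Type*) {G H : Type*} [CommRing k] [Group G]
    [TopologicalSpace G] [Group H] [TopologicalSpace H] (f : G →ₜ* H) :
    CompletedGroupAlgebra k G →ₐ[k] CompletedGroupAlgebra k H :=
  AlgHom.codRestrict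
    (AlgHom.pi fun N : OpenNormalSubgroup H =>
      ((MonoidAlgebra.mapDomainAlgHom k k
        (QuotientGroup.map (N.preimage f).toSubgroup N.toSubgroup (f : G →* H) le_rfl)).comp
          (Pi.evalAlgHom k _ (N.preimage f))).comp (CompletedGroupAlgebra k G).val)
    (CompletedGroupAlgebra k H) (by
      intro r N M h
      have hr := r.2 (N.preimage f) (M.preimage f) (Subgroup.comap_mono h)
      simp only [AlgHom.pi_apply, AlgHom.comp_apply, Pi.evalAlgHom_apply, Subalgebra.coe_val]
      rw [← hr]
      simp only [quotientAlgebraMap, ← AlgHom.comp_apply, ← MonoidAlgebra.mapDomainAlgHom_comp]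
      congr 2
      ext x
      rfl)

/-! ### Metabelian pro-`p` groups -/

/-- A profinite group is pro-`p` if all its quotients by open normal subgroups are `p`-groups. -/
class IsProP (p : ℕ) (G : Type*) [Group G] [TopologicalSpace G] [IsTopologicalGroup G]
    [CompactSpace G] [TotallyDisconnectedSpace G] : Prop where
  isPGroup : ∀ N : OpenNormalSubgroup G, IsPGroup p (G ⧸ N.toSubgroup)

/-- A group is metabelian if its second derived subgroup is trivial. -/
class IsMetabelian (G : Type*) [Group G] : Prop where
  derivedSeries_two : derivedSeries G 2 = ⊥

/-- `F`, with the elements `g i`, is a free metabelian pro-`p` group on the `g i`: every map from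
the generators to a metabelian pro-`p` group `H` extends uniquely to a continuous homomorphism
`F → H`. -/
def IsFreeMetabelianProP (p : ℕ) {ι : Type*} {F : Type u} [Group F] [TopologicalSpace F]
    (g : ι → F) : Prop :=
  ∀ (H : Type u) [Group H] [TopologicalSpace H] [IsTopologicalGroup H] [CompactSpace H]
    [TotallyDisconnectedSpace H] [IsProP p H] [IsMetabelian H] (h : ι → H),
    ∃! φ : F →ₜ* H, ∀ i, φ (g i) = h i

/-! ### Existence of free metabelian pro-`p` groups -/

namespace FreeMetabelianProP

variable (p : ℕ) (ι : Type u)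

/-- The normal subgroups `N` of the abstract free group on `ι` such that the quotient by `N` is a
finite metabelian `p`-group. -/
structure Level where
  N : Subgroup (FreeGroup ι)
  nor : N.Normal
  fin : Finite (FreeGroup ι ⧸ N)
  pg : IsPGroup p (FreeGroup ι ⧸ N)
  met : IsMetabelian (FreeGroup ι ⧸ N)

attribute [instance] Level.nor Level.fin Level.met

instance (L : Level p ι) : TopologicalSpace (FreeGroup ι ⧸ L.N) := ⊥
instance (L : Level p ι) : DiscreteTopology (FreeGroup ι ⧸ L.N) := ⟨rfl⟩

/-- The product of all these finite quotients, with the product topology. -/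
abbrev QuotientProd := ∀ L : Level p ι, FreeGroup ι ⧸ L.N

/-- The diagonal map to the product of the quotients. -/
def eta : FreeGroup ι →* QuotientProd p ι := MonoidHom.pi fun L => QuotientGroup.mk' L.N

/-- The closure of the image of the free group on `ι` in the product of its finite metabelian
`p`-quotients: the pro-`p` completion of the free metabelian group on `ι`. -/
abbrev freeGroup : Subgroup (QuotientProd p ι) := (eta p ι).range.topologicalClosure

instance : CompactSpace (freeGroup p ι) :=
    isCompact_iff_compactSpace.mp (Subgroup.isClosed_topologicalClosure _).isCompact

/-- Evaluation at a coordinate. -/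
def ev (L : Level p ι) : freeGroup p ι →* FreeGroup ι ⧸ L.N :=
  (Pi.evalMonoidHom _ L).comp (freeGroup p ι).subtype

instance : IsMetabelian (freeGroup p ι) := ⟨by
  rw [eq_bot_iff]
  intro x hx
  apply Subtype.ext
  funext L
  have : ev p ι L x ∈ derivedSeries (FreeGroup ι ⧸ L.N) 2 :=
    map_derivedSeries_le_derivedSeries (ev p ι L) 2 ⟨x, hx, rfl⟩
  rw [IsMetabelian.derivedSeries_two] at this
  exact this⟩

instance : IsProP p (freeGroup p ι) := ⟨by
  intro N y
  obtain ⟨x, rfl⟩ := QuotientGroup.mk_surjective y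
  obtain ⟨U, hU, hUN⟩ := isOpen_induced_iff.mp N.isOpen'
  have h1 : (1 : QuotientProd p ι) ∈ U := by
    have : (1 : freeGroup p ι) ∈ Subtype.val ⁻¹' U := by rw [hUN]; exact N.one_mem
    exact this
  obtain ⟨J, u, hu, hJ⟩ := isOpen_pi_iff.mp hU 1 h1
  have hk : ∀ L : Level p ι, ∃ k, x.1 L ^ p ^ k = 1 := fun L => L.pg (x.1 L)
  choose k hk using hk
  refine ⟨J.sup k, ?_⟩
  rw [← QuotientGroup.mk_pow, QuotientGroup.eq_one_iff]
  have : x ^ p ^ (J.sup k) ∈ Subtype.val ⁻¹' U := by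
    apply hJ
    intro L hL
    have : (x.1 L) ^ p ^ (J.sup k) = 1 := by
      obtain ⟨m, hm⟩ := pow_dvd_pow p (Finset.le_sup hL : k L ≤ J.sup k)
      rw [hm, pow_mul, hk, one_pow]
    have h2 : (x ^ p ^ (J.sup k)).1 L = 1 := this
    rw [h2]
    exact (hu L hL).2
  rw [hUN] at this
  exact this⟩

/-- The free generators. -/
def gen (i : ι) : freeGroup p ι := ⟨eta p ι (FreeGroup.of i), Subgroup.le_topologicalClosure _ ⟨_, rfl⟩⟩

/-- The map from the abstract free group, with dense image. -/
def eta' : FreeGroup ι →* freeGroup p ι :=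
  (eta p ι).codRestrict _ fun x => Subgroup.le_topologicalClosure _ ⟨x, rfl⟩

theorem isOpen_eval (L : Level p ι) : IsOpen {x : freeGroup p ι | x.1 L = 1} := by
  have hc : Continuous fun x : freeGroup p ι => x.1 L :=
    (continuous_apply L).comp continuous_subtype_val
  exact (isOpen_discrete {(1 : FreeGroup ι ⧸ L.N)}).preimage hc

theorem dense_eta' : DenseRange (eta' p ι) := by
  intro x
  rw [closure_subtype (X := QuotientProd p ι)]
  have hx : (x : QuotientProd p ι) ∈ closure ((eta p ι).range : Set (QuotientProd p ι)) := x.2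
  refine closure_mono ?_ hx
  rintro _ ⟨z, rfl⟩
  exact ⟨_, ⟨z, rfl⟩, rfl⟩

/-- Free metabelian pro-`p` groups exist: the concrete group above is one. -/
theorem isFree_gen : IsFreeMetabelianProP p (gen p ι) := by
  intro H _ _ _ _ _ _ _ h
  let w : FreeGroup ι →* H := FreeGroup.lift h
  let K : Subgroup (freeGroup p ι × H) := ((eta' p ι).prod w).range.topologicalClosure
  have hK : IsClosed (K : Set (freeGroup p ι × H)) := Subgroup.isClosed_topologicalClosure _
  have : CompactSpace K := isCompact_iff_compactSpace.mp hK.isCompact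
  let f : K →* freeGroup p ι := (MonoidHom.fst _ _).comp K.subtype
  have hf : Continuous f := continuous_fst.comp continuous_subtype_val
  have hsurj : Function.Surjective f := by
    have hcl : IsClosed (Set.range f) := (isCompact_range hf).isClosed
    have : Set.range (eta' p ι) ⊆ Set.range f := by
      rintro _ ⟨z, rfl⟩
      exact ⟨⟨(eta' p ι z, w z), Subgroup.le_topologicalClosure _ ⟨z, rfl⟩⟩, rfl⟩
    have h2 := closure_minimal this hcl
    rw [(dense_eta' p ι).closure_eq] at h2
    exact fun x => h2 trivial
  have hinj : Function.Injective f := by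
    rw [injective_iff_map_eq_one]
    rintro ⟨⟨x, y⟩, hxy⟩ hx
    change x = 1 at hx
    subst hx
    apply Subtype.ext
    refine Prod.ext rfl ?_
    change y = 1
    by_contra hy
    obtain ⟨V, hV⟩ := ProfiniteGrp.exist_openNormalSubgroup_sub_open_nhds_of_one
      (isOpen_compl_singleton (x := y)) (by simpa using Ne.symm hy)
    apply hV _ rfl
    have hfin : Finite (H ⧸ V.toSubgroup) :=
      inferInstanceAs (Finite (H ⧸ V.toOpenSubgroup.toSubgroup))
    let N := V.toSubgroup.comap w
    let j : FreeGroup ι ⧸ N →* H ⧸ V.toSubgroup := QuotientGroup.map _ _ w le_rfl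
    have hj : Function.Injective j := by
      rw [injective_iff_map_eq_one]
      intro x hx
      obtain ⟨x, rfl⟩ := QuotientGroup.mk_surjective x
      exact (QuotientGroup.eq_one_iff _).mpr ((QuotientGroup.eq_one_iff (N := V.toSubgroup) _).mp hx)
    let L : Level p ι := ⟨N, inferInstance, Finite.of_injective j hj,
      (IsProP.isPGroup V).of_injective j hj, ⟨by
        rw [eq_bot_iff]
        intro x hx
        have h1 : j x ∈ derivedSeries (H ⧸ V.toSubgroup) 2 :=
          map_derivedSeries_le_derivedSeries j 2 ⟨x, hx, rfl⟩
        have h2 := derivedSeries_le_map_derivedSeries (f := QuotientGroup.mk' V.toSubgroup) (QuotientGroup.mk'_surjective _) 2 h1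
        rw [IsMetabelian.derivedSeries_two] at h2
        obtain ⟨z, hz, hz'⟩ := h2
        have : z = 1 := hz
        subst this
        exact hj (hz'.symm.trans (by simp))⟩⟩
    let O : Set (freeGroup p ι × H) := {z | z.1.1 L = 1 ∧ y⁻¹ * z.2 ∈ V.toSubgroup}
    have hO : IsOpen O := by
      apply IsOpen.inter
      · exact (isOpen_eval p ι L).preimage continuous_fst
      · exact V.isOpen'.preimage (by fun_prop)
    obtain ⟨z, hz, ⟨t, rfl⟩⟩ := mem_closure_iff.mp hxy O hO ⟨rfl, by simp⟩
    have h1 : (QuotientGroup.mk t : FreeGroup ι ⧸ N) = 1 := hz.1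
    have h2 : w t ∈ V.toSubgroup := (QuotientGroup.eq_one_iff (N := N) _).mp h1
    have h3 := V.toSubgroup.mul_mem h2 (V.toSubgroup.inv_mem hz.2)
    have : w t * (y⁻¹ * w t)⁻¹ = y := by group
    change w t * (y⁻¹ * w t)⁻¹ ∈ _ at h3
    rw [this] at h3
    exact h3
  let e := MulEquiv.ofBijective f ⟨hinj, hsurj⟩
  have he : Continuous e.symm := (hf.homeoOfEquivCompactToT2 (f := e.toEquiv)).symm.continuous
  refine ⟨⟨((MonoidHom.snd _ _).comp K.subtype).comp e.symm.toMonoidHom,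
    continuous_snd.comp (continuous_subtype_val.comp he)⟩, ?_, ?_⟩
  · intro i
    have : e.symm (gen p ι i) = ⟨(eta' p ι (.of i), w (.of i)), Subgroup.le_topologicalClosure _ ⟨_, rfl⟩⟩ := by
      rw [MulEquiv.symm_apply_eq]
      rfl
    change (e.symm (gen p ι i)).1.2 = _
    rw [this]
    simp [w]
  · intro φ hφ
    apply ContinuousMonoidHom.ext
    intro x
    refine congrFun ((dense_eta' p ι).equalizer φ.continuous_toFun
      (continuous_snd.comp (continuous_subtype_val.comp he)) ?_) x
    funext z
    have h1 : (φ : freeGroup p ι →* H).comp (eta' p ι) = w :=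
      FreeGroup.ext_hom _ _ fun i => (hφ i).trans FreeGroup.lift_apply_of.symm
    have h2 : e.symm (eta' p ι z) =
        ⟨(eta' p ι z, w z), Subgroup.le_topologicalClosure _ ⟨z, rfl⟩⟩ := by
      rw [MulEquiv.symm_apply_eq]
      rfl
    change φ (eta' p ι z) = (e.symm (eta' p ι z)).1.2
    rw [h2]
    exact DFunLike.congr_fun h1 z

end FreeMetabelianProP

/-- The derived subgroup of a profinite group, in the topological sense: the closed subgroup
generated by all commutators. -/
abbrev closedDerived (F : Type*) [Group F] [TopologicalSpace F] [IsTopologicalGroup F] :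
    Subgroup F :=
  (commutator F).topologicalClosure

section Module

variable (p : ℕ) [Fact p.Prime] {F : Type*} [Group F] [TopologicalSpace F] [IsTopologicalGroup F]
  [CompactSpace F] [TotallyDisconnectedSpace F] [IsProP p F] [IsMetabelian F]

instance closedDerived.commGroup {F : Type*} [Group F] [TopologicalSpace F]
    [IsTopologicalGroup F] [TotallyDisconnectedSpace F] [IsMetabelian F] :
    CommGroup (closedDerived F) :=
  Subgroup.commGroupTopologicalClosure (commutator F) (by
    intro x y
    have h : ⁅(x : F), (y : F)⁆ ∈ derivedSeries F 2 := by
      rw [derivedSeries_succ, derivedSeries_one]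
      exact Subgroup.commutator_mem_commutator x.2 y.2
    rw [IsMetabelian.derivedSeries_two, Subgroup.mem_bot, commutatorElement_eq_one_iff_mul_comm]
      at h
    exact Subtype.ext h)

/-- The action of `X = F/F'` on `A = F'` by `a ↦ a ^ x = g⁻¹ * a * g`, where `x = g F'`
(an action on the left as well as on the right, since `X` is abelian). -/
def conjAction {F : Type*} [Group F] [TopologicalSpace F] [IsTopologicalGroup F]
    [TotallyDisconnectedSpace F] [IsMetabelian F] :
    TopologicalAbelianization F →* MulAut (closedDerived F) :=
  (QuotientGroup.lift (closedDerived F) MulAut.conjNormal (by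
    intro a ha
    ext b
    have h : (⟨a, ha⟩ : closedDerived F) * b = b * ⟨a, ha⟩ := mul_comm _ _
    have h' : a * (b : F) = b * a := congrArg Subtype.val h
    simp [MulAut.conjNormal_apply, h'])).comp invMonoidHom

/-- The image in `X = F/F'` of an open normal subgroup of `F`. -/
def OpenNormalSubgroup.imageAb {F : Type*} [Group F] [TopologicalSpace F] [IsTopologicalGroup F]
    (V : OpenNormalSubgroup F) : OpenNormalSubgroup (TopologicalAbelianization F) where
  toSubgroup := V.toSubgroup.map (QuotientGroup.mk' (closedDerived F))
  isOpen' := QuotientGroup.isOpenMap_coe _ V.isOpen'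
  isNormal' := V.isNormal'.map _ (QuotientGroup.mk'_surjective _)

/-- The finite quotient `A/(A ∩ V)` of `A = F'`, for `V` an open normal subgroup of `F`. -/
abbrev DerivedLevel {F : Type*} [Group F] [TopologicalSpace F] [IsTopologicalGroup F]
    (V : OpenNormalSubgroup F) : Type _ :=
  closedDerived F ⧸ V.toSubgroup.subgroupOf (closedDerived F)

instance DerivedLevel.commGroup {F : Type*} [Group F] [TopologicalSpace F]
    [IsTopologicalGroup F] [TotallyDisconnectedSpace F] [IsMetabelian F]
    (V : OpenNormalSubgroup F) : CommGroup (DerivedLevel V) :=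
  QuotientGroup.Quotient.commGroup _

theorem DerivedLevel.pow_smul_eq_zero (V : OpenNormalSubgroup F) (q : Additive (DerivedLevel V)) :
    (p ^ Nat.card (F ⧸ V.toSubgroup)) • q = 0 := by
  obtain ⟨a, ha⟩ := QuotientGroup.mk_surjective (s := V.toSubgroup.subgroupOf (closedDerived F))
    (Additive.toMul q)
  have hfin : Finite (F ⧸ V.toSubgroup) :=
    inferInstanceAs (Finite (F ⧸ V.toOpenSubgroup.toSubgroup))
  obtain ⟨k, hk⟩ := (IsPGroup.iff_card (p := p)).mp (IsProP.isPGroup (p := p) V)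
  have hdvd : Nat.card (F ⧸ V.toSubgroup) ∣ p ^ Nat.card (F ⧸ V.toSubgroup) := by
    conv_lhs => rw [hk]
    refine pow_dvd_pow p ?_
    rw [hk]
    exact (Nat.lt_pow_self (Fact.out : p.Prime).one_lt).le
  have h1 : (QuotientGroup.mk (a : F) : F ⧸ V.toSubgroup) ^ (p ^ Nat.card (F ⧸ V.toSubgroup)) = 1 :=
    orderOf_dvd_iff_pow_eq_one.mp ((orderOf_dvd_natCard _).trans hdvd)
  apply Additive.toMul.injective
  rw [toMul_nsmul, ← ha, toMul_zero, ← QuotientGroup.mk_pow, QuotientGroup.eq_one_iff]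
  rw [← QuotientGroup.mk_pow, QuotientGroup.eq_one_iff] at h1
  exact h1

/-- The finite abelian `p`-group `A/(A ∩ V)` is a `ℤ_p`-module: `ℤ_p` acts through its residues
modulo a power of `p` that kills `A/(A ∩ V)`. -/
instance DerivedLevel.module (V : OpenNormalSubgroup F) :
    Module ℤ_[p] (Additive (DerivedLevel V)) :=
  letI : Module (ZMod (p ^ Nat.card (F ⧸ V.toSubgroup))) (Additive (DerivedLevel V)) :=
    AddCommGroup.zmodModule (DerivedLevel.pow_smul_eq_zero p V)
  Module.compHom _ (PadicInt.toZModPow (p := p) (Nat.card (F ⧸ V.toSubgroup)))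

theorem DerivedLevel.map_padic_smul (V : OpenNormalSubgroup F) {M : Type*} [AddCommGroup M]
    [Module ℤ_[p] M] (f : Additive (DerivedLevel V) →+ M) (c : ℤ_[p])
    (q : Additive (DerivedLevel V)) : f (c • q) = c • f q := by
  obtain ⟨w, hw⟩ := Ideal.mem_span_singleton'.mp
    (PadicInt.appr_spec (p := p) (Nat.card (F ⧸ V.toSubgroup)) c)
  have hc : c = (c.appr (Nat.card (F ⧸ V.toSubgroup)) : ℤ_[p]) +
      w * ((p ^ Nat.card (F ⧸ V.toSubgroup) : ℕ) : ℤ_[p]) := by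
    push_cast
    rw [hw]
    ring
  rw [hc, add_smul, add_smul, mul_smul, mul_smul, Nat.cast_smul_eq_nsmul, Nat.cast_smul_eq_nsmul,
    Nat.cast_smul_eq_nsmul, Nat.cast_smul_eq_nsmul, ← map_nsmul, ← map_nsmul, map_add,
    pow_smul_eq_zero, smul_zero, map_zero, smul_zero]

/-- The projection of `A = F'`, written additively, onto `A/(A ∩ V)`. -/
def DerivedLevel.proj (V : OpenNormalSubgroup F) :
    Additive (closedDerived F) →+ Additive (DerivedLevel V) :=
  MonoidHom.toAdditive (QuotientGroup.mk' (V.toSubgroup.subgroupOf (closedDerived F)))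

theorem DerivedLevel.proj_surjective {F : Type*} [Group F] [TopologicalSpace F]
    [IsTopologicalGroup F] (V : OpenNormalSubgroup F) :
    Function.Surjective (DerivedLevel.proj V) :=
  QuotientGroup.mk'_surjective (V.toSubgroup.subgroupOf (closedDerived F))

/-- The action of `X/(image of V)` on `A/(A ∩ V)` induced by the action of `X` on `A`. -/
def DerivedLevel.action (V : OpenNormalSubgroup F) :
    TopologicalAbelianization F ⧸ V.imageAb.toSubgroup →*
      AddMonoid.End (Additive (DerivedLevel V)) :=
  QuotientGroup.lift _
    { toFun := fun x => MonoidHom.toAdditive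
        (QuotientGroup.map _ _ (conjAction x).toMonoidHom (by
          obtain ⟨g, rfl⟩ := QuotientGroup.mk_surjective x
          intro a ha
          have := V.isNormal'.conj_mem _ ha g⁻¹
          exact this))
      map_one' := by
        ext q
        obtain ⟨a, rfl⟩ := DerivedLevel.proj_surjective V q
        exact congrArg (fun b => DerivedLevel.proj V (Additive.ofMul b))
          (DFunLike.congr_fun (map_one conjAction) a.toMul)
      map_mul' := fun x y => by
        ext q
        obtain ⟨a, rfl⟩ := DerivedLevel.proj_surjective V q
        exact congrArg (fun b => DerivedLevel.proj V (Additive.ofMul b))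
          (DFunLike.congr_fun (map_mul conjAction x y) a.toMul) }
    (by
      rintro _ ⟨g, hg, rfl⟩
      ext q
      obtain ⟨a, rfl⟩ := DerivedLevel.proj_surjective V q
      refine (QuotientGroup.eq (s := V.toSubgroup.subgroupOf (closedDerived F))).mpr ?_
      have h1 := V.toSubgroup.mul_mem (V.toSubgroup.inv_mem hg)
        (V.isNormal'.conj_mem g hg (a.toMul : F)⁻¹)
      have h2 : ((g⁻¹ * (a.toMul : F) * g⁻¹⁻¹)⁻¹ * (a.toMul : F)) ∈ V.toSubgroup := by
        convert h1 using 1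
        group
      exact h2)

/-- The `ℤ_p`-linear representation of `X/(image of V)` on `A/(A ∩ V)`. -/
def DerivedLevel.rep (V : OpenNormalSubgroup F) :
    Representation ℤ_[p] (TopologicalAbelianization F ⧸ V.imageAb.toSubgroup)
      (Additive (DerivedLevel V)) where
  toFun x :=
    { DerivedLevel.action V x with
      map_smul' := fun c q => DerivedLevel.map_padic_smul p V (DerivedLevel.action V x) c q }
  map_one' := by
    ext q
    exact DFunLike.congr_fun (map_one (DerivedLevel.action V)) q
  map_mul' x y := by
    ext q
    exact DFunLike.congr_fun (map_mul (DerivedLevel.action V) x y) q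

/-- `ℤ_p[[X]]` acts on `A/(A ∩ V)` through the group algebra `ℤ_p[X/(image of V)]`. -/
def DerivedLevel.ringHom (V : OpenNormalSubgroup F) :
    CompletedGroupAlgebra ℤ_[p] (TopologicalAbelianization F) →ₐ[ℤ_[p]]
      Module.End ℤ_[p] (Additive (DerivedLevel V)) :=
  ((DerivedLevel.rep p V).asAlgebraHom.comp (Pi.evalAlgHom ℤ_[p] _ V.imageAb)).comp
    (CompletedGroupAlgebra ℤ_[p] (TopologicalAbelianization F)).val

/-- The projection `A/(A ∩ V) → A/(A ∩ W)` for `V ≤ W`. -/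
def DerivedLevel.trans {V W : OpenNormalSubgroup F} (h : V.toSubgroup ≤ W.toSubgroup) :
    Additive (DerivedLevel V) →+ Additive (DerivedLevel W) :=
  MonoidHom.toAdditive (QuotientGroup.map _ _ (MonoidHom.id _) (fun _ ha => h ha))

theorem DerivedLevel.trans_ringHom {V W : OpenNormalSubgroup F}
    (h : V.toSubgroup ≤ W.toSubgroup)
    (r : CompletedGroupAlgebra ℤ_[p] (TopologicalAbelianization F))
    (q : Additive (DerivedLevel V)) :
    DerivedLevel.trans h (DerivedLevel.ringHom p V r q) =
      DerivedLevel.ringHom p W r (DerivedLevel.trans h q) := by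
  have hle : V.imageAb.toSubgroup ≤ W.imageAb.toSubgroup := Subgroup.map_mono h
  have hr := r.2 V.imageAb W.imageAb hle
  simp only [DerivedLevel.ringHom, AlgHom.comp_apply, Pi.evalAlgHom_apply, Subalgebra.coe_val]
  rw [← hr]
  generalize r.1 V.imageAb = s
  induction s using MonoidAlgebra.induction_linear with
  | zero => simp
  | add s t hs ht => simp only [map_add, LinearMap.add_apply, hs, ht]
  | single x c =>
    obtain ⟨x, rfl⟩ := QuotientGroup.mk_surjective x
    obtain ⟨a, rfl⟩ := DerivedLevel.proj_surjective V q
    rw [quotientAlgebraMap_single,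
      Representation.asAlgebraHom_single, Representation.asAlgebraHom_single,
      LinearMap.smul_apply, LinearMap.smul_apply, DerivedLevel.map_padic_smul]
    rfl

theorem closedDerived.ext_proj {F : Type*} [Group F] [TopologicalSpace F] [IsTopologicalGroup F]
    [CompactSpace F] [TotallyDisconnectedSpace F] {a b : Additive (closedDerived F)}
    (h : ∀ V : OpenNormalSubgroup F, DerivedLevel.proj V a = DerivedLevel.proj V b) : a = b := by
  apply Additive.toMul.injective
  apply Subtype.ext
  by_contra hne
  have hne' : ((a.toMul : F))⁻¹ * (b.toMul : F) ≠ 1 := fun h1 => hne (inv_mul_eq_one.mp h1)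
  obtain ⟨V, hV⟩ := ProfiniteGrp.exist_openNormalSubgroup_sub_open_nhds_of_one
    (isOpen_compl_singleton (x := ((a.toMul : F))⁻¹ * (b.toMul : F))) (by
      simpa using hne'.symm)
  have h1 : ((a.toMul : F))⁻¹ * (b.toMul : F) ∈ V.toSubgroup :=
    (QuotientGroup.eq (s := V.toSubgroup.subgroupOf (closedDerived F))).mp (h V)
  exact hV h1 rfl

theorem closedDerived.exists_smul
    (r : CompletedGroupAlgebra ℤ_[p] (TopologicalAbelianization F))
    (a : Additive (closedDerived F)) :
    ∃ b : Additive (closedDerived F), ∀ V : OpenNormalSubgroup F,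
      DerivedLevel.proj V b = DerivedLevel.ringHom p V r (DerivedLevel.proj V a) := by
  have hcpt : CompactSpace (closedDerived F) :=
    isCompact_iff_compactSpace.mp (Subgroup.isClosed_topologicalClosure _).isCompact
  let C : OpenNormalSubgroup F → Set (closedDerived F) := fun V =>
    {b | DerivedLevel.proj V (Additive.ofMul b) =
      DerivedLevel.ringHom p V r (DerivedLevel.proj V a)}
  have hne : ∀ V, (C V).Nonempty := fun V => by
    obtain ⟨b, hb⟩ := DerivedLevel.proj_surjective V
      (DerivedLevel.ringHom p V r (DerivedLevel.proj V a))
    exact ⟨b.toMul, hb⟩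
  have hcl : ∀ V, IsClosed (C V) := fun V => by
    obtain ⟨b, hb⟩ := hne V
    have : C V = (fun c : closedDerived F => (b : F)⁻¹ * (c : F)) ⁻¹' (V : Set F) := by
      ext c
      change _ = _ ↔ _
      rw [← hb, eq_comm]
      exact QuotientGroup.eq
    rw [this]
    exact V.toOpenSubgroup.isClosed.preimage (by fun_prop)
  have hmono : ∀ V W : OpenNormalSubgroup F, V.toSubgroup ≤ W.toSubgroup → C V ⊆ C W := by
    intro V W h b hb
    have := congrArg (DerivedLevel.trans h) hb
    rw [DerivedLevel.trans_ringHom] at this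
    exact this
  have hdir : Directed (· ⊇ ·) C := fun V W =>
    ⟨V ⊓ W, hmono _ _ (fun _ hx => hx.1), hmono _ _ (fun _ hx => hx.2)⟩
  have : Nonempty (OpenNormalSubgroup F) :=
    ⟨(ProfiniteGrp.exist_openNormalSubgroup_sub_open_nhds_of_one isOpen_univ
      (Set.mem_univ (1 : F))).choose⟩
  obtain ⟨b, hb⟩ := IsCompact.nonempty_iInter_of_directed_nonempty_isCompact_isClosed C hdir hne
    (fun V => (hcl V).isCompact) hcl
  exact ⟨Additive.ofMul b, fun V => Set.mem_iInter.mp hb V⟩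

/-- The action of `ℤ_p[[X]]` on `A = lim A/(A ∩ V)` (written additively) : `r • a` is the unique
element of `A` whose image in each `A/(A ∩ V)` is the image of `a` acted upon by `r`. -/
instance closedDerived.smul :
    SMul (CompletedGroupAlgebra ℤ_[p] (TopologicalAbelianization F))
      (Additive (closedDerived F)) where
  smul r a := (closedDerived.exists_smul p r a).choose

theorem closedDerived.proj_smul (V : OpenNormalSubgroup F)
    (r : CompletedGroupAlgebra ℤ_[p] (TopologicalAbelianization F))
    (a : Additive (closedDerived F)) :
    DerivedLevel.proj V (r • a) = DerivedLevel.ringHom p V r (DerivedLevel.proj V a) :=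
  (closedDerived.exists_smul p r a).choose_spec V

/-- `A = F'` is a module over the completed group algebra `ℤ_p[[X]]`. -/
instance closedDerived.module :
    Module (CompletedGroupAlgebra ℤ_[p] (TopologicalAbelianization F))
      (Additive (closedDerived F)) where
  one_smul a := closedDerived.ext_proj fun V => by simp [closedDerived.proj_smul]
  mul_smul r s a := closedDerived.ext_proj fun V => by simp [closedDerived.proj_smul]
  smul_zero r := closedDerived.ext_proj fun V => by simp [closedDerived.proj_smul]
  smul_add r a b := closedDerived.ext_proj fun V => by simp [closedDerived.proj_smul]
  add_smul r s a := closedDerived.ext_proj fun V => by simp [closedDerived.proj_smul]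
  zero_smul a := closedDerived.ext_proj fun V => by simp [closedDerived.proj_smul]

end Module

/-! ### The data of the normal form -/

section NormalForm

variable {d : ℕ} {F : Type*} [Group F] [TopologicalSpace F] [IsTopologicalGroup F]

/-- The closed subgroup `X_j` of `X = F/F'` topologically generated by the images of `g_i`, for
`i ≤ j`. -/
def closedSpan (g : Fin d → F) (j : Fin d) : Subgroup (TopologicalAbelianization F) :=
  (Subgroup.closure ((fun i => (g i : TopologicalAbelianization F)) '' Set.Iic j)).topologicalClosure

/-- The continuous inclusion of a subgroup. -/
def inclusionHom {G : Type*} [Group G] [TopologicalSpace G] (H : Subgroup G) : H →ₜ* G where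
  toMonoidHom := H.subtype
  continuous_toFun := continuous_subtype_val

/-- The element `u_ij = [g_i, g_j] = g_i⁻¹ g_j⁻¹ g_i g_j` of `A = F'`, written additively. -/
def basicCommutator (g : Fin d → F) (i j : Fin d) : Additive (closedDerived F) :=
  Additive.ofMul ⟨(g i)⁻¹ * (g j)⁻¹ * g i * g j, Subgroup.le_topologicalClosure _ (by
    have h := Subgroup.commutator_mem_commutator (Subgroup.mem_top (g i)⁻¹)
      (Subgroup.mem_top (g j)⁻¹)
    rw [commutatorElement_def, inv_inv, inv_inv] at h
    exact h)⟩

end NormalForm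

end

/-!
Existence: the image of `r ↦ ∑ u_ij r_ij` is closed, since the `R_j` are compact, and the
Hall–Witt identity, which in the abelian group `A` reads
`u_ij (x_k - 1) = u_ik (x_j - 1) - u_jk (x_i - 1)`, shows that it is stable under the action of the
generators; as it contains the commutators of the generators, it is all of `A`.

Uniqueness: let `m` be the largest second index with some `r_km ≠ 0`. A character `χ` of a finite
quotient `Y` of `X` with values in a finite ring `B` gives homomorphisms from `F` to the Magnus
group of pairs `(y, b)`, with `g_i ↦ (y_i, b_i)` for arbitrary `b_i`, under which `u_ij` has
`B`-component `(χ y_j - 1) b_i - (χ y_i - 1) b_j`. Taking `b_k = 1` and `b_i = 0` for `i ≠ k` and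
comparing the given value of `y_m` with `y_m = 1` isolates the relation `(x_m - 1) r_km = 0` in `B`.
For `B = (ℤ/p^l)[Y]` and `Y = (ℤ/p^(n+l))^d` this says that `r_km` is invariant under translation by
`x_m`, so that its image in `(ℤ/p^l)[(ℤ/p^n)^d]` is a multiple of `p^l`, hence zero. Since `l` and
`n` are arbitrary and the kernels of the maps `X_m → (ℤ/p^n)^d` are cofinal among the open subgroups
of `X_m`, it follows that `r_km = 0`.
-/

noncomputable section

/-! ### Homomorphisms to finite quotients -/

theorem mapDomain_mapDomain_of_comp_eq {k M N O : Type*} [Semiring k] {f : M → N} {f' : N → O}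
    {h : M → O} (hcomp : ∀ x, f' (f x) = h x) (s : MonoidAlgebra k M) :
    MonoidAlgebra.mapDomain f' (MonoidAlgebra.mapDomain f s) = MonoidAlgebra.mapDomain h s := by
  obtain rfl : f' ∘ f = h := funext hcomp
  exact (DFunLike.congr_fun (MonoidAlgebra.mapDomainLinearMap_comp (R := k) (S := k) f f') s).symm

/-- The kernel of a continuous homomorphism to a discrete group, as an open normal subgroup. -/
def openKer {G Y : Type*} [Group G] [TopologicalSpace G] [Group Y] [TopologicalSpace Y]
    [DiscreteTopology Y] (ψ : G →ₜ* Y) : OpenNormalSubgroup G where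
  toSubgroup := (ψ : G →* Y).ker
  isOpen' := (isOpen_discrete {1}).preimage ψ.continuous_toFun
  isNormal' := inferInstance

theorem finite_quotient_openNormalSubgroup {G : Type*} [Group G] [TopologicalSpace G]
    [IsTopologicalGroup G] [CompactSpace G] (N : OpenNormalSubgroup G) :
    Finite (G ⧸ N.toSubgroup) :=
  inferInstanceAs (Finite (G ⧸ N.toOpenSubgroup.toSubgroup))

namespace CompletedGroupAlgebra

section Functoriality

variable {k G H K Y Z : Type*} [CommRing k] [Group G] [TopologicalSpace G] [Group H]
  [TopologicalSpace H] [Group K] [TopologicalSpace K] [Group Y] [TopologicalSpace Y]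
  [DiscreteTopology Y] [Group Z] [TopologicalSpace Z] [DiscreteTopology Z]

theorem ext_val {r s : CompletedGroupAlgebra k G} (h : ∀ N, r.1 N = s.1 N) : r = s :=
  Subtype.ext (funext h)

protected theorem mul_comm {G : Type*} [CommGroup G] [TopologicalSpace G]
    (r s : CompletedGroupAlgebra k G) : r * s = s * r :=
  ext_val fun N => mul_comm (r.1 N) (s.1 N)

/-- The canonical homomorphism from `G` to `k[[G]]`. -/
def of (k : Type*) {G : Type*} [CommRing k] [Group G] [TopologicalSpace G] :
    G →* CompletedGroupAlgebra k G where
  toFun x := ⟨fun N => MonoidAlgebra.single (x : G ⧸ N.toSubgroup) 1,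
    fun N M h => quotientAlgebraMap_single N.toSubgroup M.toSubgroup h x 1⟩
  map_one' := rfl
  map_mul' x y := ext_val fun N => by simp [MonoidAlgebra.single_mul_single]

theorem map_of (f : G →ₜ* H) (x : G) : map k f (of k x) = of k (f x) :=
  ext_val fun _ => MonoidAlgebra.mapDomain_single

theorem map_map (f : G →ₜ* H) (f' : H →ₜ* K) (r : CompletedGroupAlgebra k G) :
    map k f' (map k f r) = map k (f'.comp f) r :=
  ext_val fun _ =>
    mapDomain_mapDomain_of_comp_eq (fun x => QuotientGroup.induction_on x fun _ => rfl) _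

/-- The algebra homomorphism `k[[G]] → k[Y]` induced by a continuous homomorphism to a discrete
group `Y`. -/
def toGroupAlgebra (k : Type*) [CommRing k] (ψ : G →ₜ* Y) :
    CompletedGroupAlgebra k G →ₐ[k] MonoidAlgebra k Y :=
  ((MonoidAlgebra.mapDomainAlgHom k k (QuotientGroup.kerLift (ψ : G →* Y))).comp
    (Pi.evalAlgHom k (fun N : OpenNormalSubgroup G => MonoidAlgebra k (G ⧸ N.toSubgroup))
      (openKer ψ))).comp (CompletedGroupAlgebra k G).val

theorem toGroupAlgebra_eq_of_le (ψ : G →ₜ* Y) (N : OpenNormalSubgroup G)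
    (hN : N.toSubgroup ≤ (ψ : G →* Y).ker) (r : CompletedGroupAlgebra k G) :
    toGroupAlgebra k ψ r =
      MonoidAlgebra.mapDomain (QuotientGroup.lift N.toSubgroup (ψ : G →* Y) hN) (r.1 N) := by
  change MonoidAlgebra.mapDomain (QuotientGroup.kerLift (ψ : G →* Y)) (r.1 (openKer ψ)) = _
  rw [← r.2 N (openKer ψ) hN]
  exact mapDomain_mapDomain_of_comp_eq (fun x => QuotientGroup.induction_on x fun _ => rfl) _

theorem toGroupAlgebra_map (f : G →ₜ* H) (ψ : H →ₜ* Y) (r : CompletedGroupAlgebra k G) :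
    toGroupAlgebra k ψ (map k f r) = toGroupAlgebra k (ψ.comp f) r :=
  mapDomain_mapDomain_of_comp_eq (fun x => QuotientGroup.induction_on x fun _ => rfl) _

theorem mapDomain_toGroupAlgebra (π : Y →ₜ* Z) (ψ : G →ₜ* Y) (r : CompletedGroupAlgebra k G) :
    MonoidAlgebra.mapDomain π (toGroupAlgebra k ψ r) = toGroupAlgebra k (π.comp ψ) r := by
  have hker : (openKer ψ).toSubgroup ≤ (π.comp ψ : G →* Z).ker := fun x (hx : ψ x = 1) =>
    (congrArg π hx).trans (map_one π)
  rw [toGroupAlgebra_eq_of_le (π.comp ψ) (openKer ψ) hker]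
  exact mapDomain_mapDomain_of_comp_eq (fun x => QuotientGroup.induction_on x fun _ => rfl) _

theorem val_eq_zero_of_toGroupAlgebra_eq_zero {ψ : G →ₜ* Y} {N : OpenNormalSubgroup G}
    (hN : (openKer ψ).toSubgroup ≤ N.toSubgroup) {r : CompletedGroupAlgebra k G}
    (hr : toGroupAlgebra k ψ r = 0) : r.1 N = 0 := by
  have hker : r.1 (openKer ψ) = 0 :=
    MonoidAlgebra.mapDomain_injective (QuotientGroup.kerLift_injective (ψ : G →* Y))
      (hr.trans (MonoidAlgebra.mapDomain_zero _).symm)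
  rw [← r.2 (openKer ψ) N hN, hker, map_zero]

end Functoriality

end CompletedGroupAlgebra

/-! ### Compactness and continuity -/

section Topology

/-- The module topology on a group algebra: for a finite group, coefficientwise convergence. -/
abbrev groupAlgebraTopology (k Q : Type*) [Semiring k] [TopologicalSpace k] :
    TopologicalSpace (MonoidAlgebra k Q) :=
  moduleTopology k (MonoidAlgebra k Q)

attribute [local instance] groupAlgebraTopology

local instance isModuleTopology_groupAlgebra (k Q : Type*) [Semiring k] [TopologicalSpace k] :
    IsModuleTopology k (MonoidAlgebra k Q) :=
  ⟨rfl⟩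

section GroupAlgebra

variable {k Q : Type*} [CommRing k] [TopologicalSpace k] [IsTopologicalRing k]

theorem compactSpace_groupAlgebra [Finite Q] [CompactSpace k] :
    CompactSpace (MonoidAlgebra k Q) := by
  let e : (Q → k) ≃ₗ[k] MonoidAlgebra k Q :=
    ((MonoidAlgebra.coeffLinearEquiv k).trans (Finsupp.linearEquivFunOnFinite k k Q)).symm
  have := IsModuleTopology.toContinuousAdd k (MonoidAlgebra k Q)
  exact e.surjective.compactSpace (IsModuleTopology.continuous_of_linearMap e.toLinearMap)

theorem t2Space_groupAlgebra [T2Space k] : T2Space (MonoidAlgebra k Q) :=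
  .of_injective_continuous (f := fun s x => s.coeff x)
    (DFunLike.coe_injective.comp MonoidAlgebra.coeff_injective)
    (IsModuleTopology.continuous_of_linearMap
      (Finsupp.lcoeFun.comp (MonoidAlgebra.coeffLinearEquiv k).toLinearMap))

end GroupAlgebra

namespace CompletedGroupAlgebra

variable {k G : Type*} [CommRing k] [TopologicalSpace k] [Group G] [TopologicalSpace G]

theorem continuous_val (N : OpenNormalSubgroup G) :
    Continuous fun r : CompletedGroupAlgebra k G => r.1 N :=
  (continuous_apply N).comp continuous_subtype_val

variable [IsTopologicalRing k] [T2Space k]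

theorem isClosed :
    IsClosed (CompletedGroupAlgebra k G :
      Set (∀ N : OpenNormalSubgroup G, MonoidAlgebra k (G ⧸ N.toSubgroup))) := by
  have := fun M : OpenNormalSubgroup G =>
    t2Space_groupAlgebra (k := k) (Q := G ⧸ M.toSubgroup)
  have := fun M : OpenNormalSubgroup G =>
    IsModuleTopology.toContinuousAdd k (MonoidAlgebra k (G ⧸ M.toSubgroup))
  have hcompatible : IsClosed {r : ∀ N : OpenNormalSubgroup G, MonoidAlgebra k (G ⧸ N.toSubgroup) |
      ∀ (N M : OpenNormalSubgroup G) (h : N.toSubgroup ≤ M.toSubgroup),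
        quotientAlgebraMap k N.toSubgroup M.toSubgroup h (r N) = r M} := by
    simp only [Set.ofPred_forall]
    exact isClosed_iInter fun N => isClosed_iInter fun M => isClosed_iInter fun h => isClosed_eq
      ((IsModuleTopology.continuous_of_linearMap (quotientAlgebraMap k _ _ h).toLinearMap).comp
        (continuous_apply N)) (continuous_apply M)
  exact hcompatible

theorem compactSpace [CompactSpace k] [IsTopologicalGroup G] [CompactSpace G] :
    CompactSpace (CompletedGroupAlgebra k G) :=
  have := fun N : OpenNormalSubgroup G => finite_quotient_openNormalSubgroup N
  have := fun N : OpenNormalSubgroup G =>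
    compactSpace_groupAlgebra (k := k) (Q := G ⧸ N.toSubgroup)
  isCompact_iff_compactSpace.mp isClosed.isCompact

end CompletedGroupAlgebra

theorem continuousSMul_of_torsion {p : ℕ} [Fact p.Prime] {M : Type*} [AddCommGroup M]
    [Module ℤ_[p] M] [TopologicalSpace M] [DiscreteTopology M]
    (htors : ∀ m : M, ∃ n : ℕ, p ^ n • m = 0) : ContinuousSMul ℤ_[p] M := by
  refine ⟨continuous_prod_of_discrete_right.mpr fun m => ?_⟩
  obtain ⟨n, hn⟩ := htors m
  refine continuous_of_continuousAt_zero (AddMonoidHom.flip (smulAddHom ℤ_[p] M) m) ?_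
  have hp : (0 : ℝ) < (p : ℝ) ^ (-(n : ℤ)) :=
    zpow_pos (by exact_mod_cast (Fact.out : p.Prime).pos) _
  refine tendsto_nhds_of_eventually_eq ?_
  filter_upwards [Metric.ball_mem_nhds 0 hp] with c hc
  obtain ⟨w, rfl⟩ := Ideal.mem_span_singleton'.mp
    ((PadicInt.norm_le_pow_iff_mem_span_pow c n).mp (mem_ball_zero_iff.mp hc).le)
  change (w * (p : ℤ_[p]) ^ n) • m = (0 : ℤ_[p]) • m
  rw [mul_smul, ← Nat.cast_pow, Nat.cast_smul_eq_nsmul, hn, smul_zero, zero_smul]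

section DerivedSubgroup

variable {F : Type*} [Group F] [TopologicalSpace F] [IsTopologicalGroup F]

theorem DerivedLevel.discreteTopology (V : OpenNormalSubgroup F) :
    DiscreteTopology (DerivedLevel V) :=
  QuotientGroup.discreteTopology (V.isOpen'.preimage continuous_subtype_val)

variable [CompactSpace F]

instance closedDerived.compactSpace : CompactSpace (closedDerived F) :=
  isCompact_iff_compactSpace.mp (Subgroup.isClosed_topologicalClosure _).isCompact

variable [TotallyDisconnectedSpace F]

theorem closedDerived.isClosedEmbedding_proj :
    Topology.IsClosedEmbedding fun (a : Additive (closedDerived F)) (V : OpenNormalSubgroup F) =>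
      DerivedLevel.proj V a :=
  have := DerivedLevel.discreteTopology (F := F)
  have hproj (V : OpenNormalSubgroup F) : Continuous (DerivedLevel.proj V) :=
    continuous_quot_mk
  (continuous_pi hproj).isClosedEmbedding fun _ _ h => closedDerived.ext_proj (congrFun h)

variable {p : ℕ} [Fact p.Prime] [IsProP p F] [IsMetabelian F]

theorem closedDerived.continuous_smul_left {G : Type*} [Group G] [TopologicalSpace G]
    (f : G →ₜ* TopologicalAbelianization F) (u : Additive (closedDerived F)) :
    Continuous fun r : CompletedGroupAlgebra ℤ_[p] G =>
      CompletedGroupAlgebra.map ℤ_[p] f r • u := by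
  refine closedDerived.isClosedEmbedding_proj.continuous_iff.mpr (continuous_pi fun V => ?_)
  have := DerivedLevel.discreteTopology V
  have : ContinuousSMul ℤ_[p] (Additive (DerivedLevel V)) := continuousSMul_of_torsion fun q =>
    ⟨_, DerivedLevel.pow_smul_eq_zero p V q⟩
  let L : MonoidAlgebra ℤ_[p] (G ⧸ (V.imageAb.preimage f).toSubgroup) →ₗ[ℤ_[p]]
      Additive (DerivedLevel V) :=
    (LinearMap.applyₗ (DerivedLevel.proj V u)).comp
      (((DerivedLevel.rep p V).asAlgebraHom.comp (MonoidAlgebra.mapDomainAlgHom ℤ_[p] ℤ_[p]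
        (QuotientGroup.map _ _ (f : G →* TopologicalAbelianization F) le_rfl))).toLinearMap)
  have hL : Continuous L := IsModuleTopology.continuous_of_linearMap L
  convert hL.comp (CompletedGroupAlgebra.continuous_val (V.imageAb.preimage f)) using 2 with r
  exact closedDerived.proj_smul p V _ u

end DerivedSubgroup

end Topology

/-! ### Topological generation -/

section Generation

theorem mul_comm_of_topologicalClosure_closure_eq_top {G : Type*} [Group G] [TopologicalSpace G]
    [IsTopologicalGroup G] [T2Space G] {S : Set G}
    (hS : (Subgroup.closure S).topologicalClosure = ⊤) (hcomm : ∀ x ∈ S, ∀ y ∈ S, x * y = y * x)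
    (x y : G) : x * y = y * x := by
  have le_centralizer {T : Set G} (hT : S ⊆ Set.centralizer T) : ⊤ ≤ Subgroup.centralizer T :=
    hS ▸ Subgroup.topologicalClosure_minimal _ ((Subgroup.closure_le _).mpr hT)
      (Set.isClosed_centralizer T)
  have hS_central : ⊤ ≤ Subgroup.centralizer S :=
    le_centralizer fun x hx y hy => hcomm y hy x hx
  have htop_central : ⊤ ≤ Subgroup.centralizer (Set.univ : Set G) :=
    le_centralizer fun x hx y _ => (hS_central (Subgroup.mem_top y) x hx).symm
  exact (htop_central (Subgroup.mem_top y) x trivial)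

theorem isClosed_normalizer {G : Type*} [Group G] [TopologicalSpace G] [IsTopologicalGroup G]
    {P : Subgroup G} (hP : IsClosed (P : Set G)) :
    IsClosed (Subgroup.normalizer (P : Set G) : Set G) := by
  have hinter : (Subgroup.normalizer (P : Set G) : Set G) =
      ⋂ x ∈ P, {f | f * x * f⁻¹ ∈ P} ∩ {f | f⁻¹ * x * f ∈ P} := by
    ext f
    simp only [Set.mem_iInter₂, SetLike.mem_coe]
    refine ⟨fun hf x hx => ⟨(Subgroup.mem_normalizer_iff.mp hf x).mp hx,
      (Subgroup.mem_normalizer_iff''.mp hf x).mp hx⟩, fun hf => Subgroup.mem_normalizer_iff.mpr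
        fun x => ⟨fun hx => (hf x hx).1, fun hx => ?_⟩⟩
    simpa [mul_assoc] using (hf _ hx).2
  rw [hinter]
  exact isClosed_biInter fun x _ => (hP.preimage (by fun_prop)).inter (hP.preimage (by fun_prop))

theorem commutator_le_of_topologicalClosure_closure_eq_top {G : Type*} [Group G]
    [TopologicalSpace G] [IsTopologicalGroup G] {S : Set G}
    (hS : (Subgroup.closure S).topologicalClosure = ⊤) {P : Subgroup G}
    (hP : IsClosed (P : Set G)) (hnormalizes : S ⊆ Subgroup.normalizer (P : Set G))
    (hcomm : ∀ x ∈ S, ∀ y ∈ S, x⁻¹ * y⁻¹ * x * y ∈ P) : commutator G ≤ P := by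
  have hnormal : P.Normal := Subgroup.normalizer_eq_top_iff.mp <| top_le_iff.mp <|
    hS ▸ Subgroup.topologicalClosure_minimal _ ((Subgroup.closure_le _).mpr hnormalizes)
      (isClosed_normalizer hP)
  have : IsClosed (P : Set G) := hP
  have hquot : (Subgroup.closure (QuotientGroup.mk' P '' S)).topologicalClosure = ⊤ := by
    rw [← MonoidHom.map_closure]
    exact DenseRange.topologicalClosure_map_subgroup (f := QuotientGroup.mk' P)
      QuotientGroup.continuous_mk (QuotientGroup.mk'_surjective P).denseRange hS
  refine Subgroup.Normal.quotient_commutative_iff_commutator_le.mp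
    ⟨⟨mul_comm_of_topologicalClosure_closure_eq_top hquot ?_⟩⟩
  rintro _ ⟨x, hx, rfl⟩ _ ⟨y, hy, rfl⟩
  refine (QuotientGroup.eq.mpr ?_ : ((y * x : G) : G ⧸ P) = (x * y : G)).symm
  simpa only [mul_inv_rev, mul_assoc] using hcomm x hx y hy

theorem IsMetabelian.of_injective {G K : Type*} [Group G] [IsMetabelian G] [Group K]
    (f : K →* G) (hf : Function.Injective f) : IsMetabelian K where
  derivedSeries_two := (Subgroup.map_eq_bot_iff_of_injective _ hf).mp <| eq_bot_iff.mpr <|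
    IsMetabelian.derivedSeries_two (G := G) ▸ map_derivedSeries_le_derivedSeries f 2

section ProP

variable {p : ℕ} {F : Type*} [Group F] [TopologicalSpace F] [IsTopologicalGroup F]
  [CompactSpace F] [TotallyDisconnectedSpace F] [IsProP p F]

theorem IsProP.exists_forall_pow_mem [Fact p.Prime] (V : OpenNormalSubgroup F) :
    ∃ n : ℕ, ∀ x : F, x ^ p ^ n ∈ V.toSubgroup := by
  have := finite_quotient_openNormalSubgroup V
  obtain ⟨n, hn⟩ := IsPGroup.iff_card.mp (IsProP.isPGroup (p := p) V)
  refine ⟨n, fun x => (QuotientGroup.eq_one_iff (x ^ p ^ n)).mp ?_⟩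
  rw [QuotientGroup.mk_pow, ← hn, pow_card_eq_one']

theorem IsProP.of_subgroup (K : Subgroup F) [CompactSpace K] : IsProP p K where
  isPGroup N y := by
    obtain ⟨x, rfl⟩ := QuotientGroup.mk_surjective y
    obtain ⟨U, hU, hUN⟩ := isOpen_induced_iff.mp N.isOpen'
    have h_one : (1 : K) ∈ Subtype.val ⁻¹' U := hUN ▸ N.one_mem
    obtain ⟨V, hVU⟩ := ProfiniteGrp.exist_openNormalSubgroup_sub_open_nhds_of_one hU h_one
    obtain ⟨n, hn⟩ := IsProP.isPGroup (p := p) V (x : F)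
    refine ⟨n, (QuotientGroup.eq_one_iff (x ^ p ^ n)).mpr ?_⟩
    have hxU : x ^ p ^ n ∈ Subtype.val ⁻¹' U :=
      hVU ((QuotientGroup.eq_one_iff ((x : F) ^ p ^ n)).mp hn)
    rwa [hUN] at hxU

end ProP

theorem IsFreeMetabelianProP.topologicalClosure_closure_eq_top {p : ℕ} {ι : Type*} {F : Type u}
    [Group F] [TopologicalSpace F] [IsTopologicalGroup F] [CompactSpace F]
    [TotallyDisconnectedSpace F] [IsProP p F] [IsMetabelian F] {g : ι → F}
    (hF : IsFreeMetabelianProP p g) :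
    (Subgroup.closure (Set.range g)).topologicalClosure = ⊤ := by
  set K := (Subgroup.closure (Set.range g)).topologicalClosure
  have hgK (i : ι) : g i ∈ K :=
    Subgroup.le_topologicalClosure _ (Subgroup.subset_closure ⟨i, rfl⟩)
  have : CompactSpace K :=
    isCompact_iff_compactSpace.mp (Subgroup.isClosed_topologicalClosure _).isCompact
  have : IsProP p K := .of_subgroup K
  have : IsMetabelian K := .of_injective K.subtype K.subtype_injective
  obtain ⟨φ, hφ, -⟩ := hF K fun i => ⟨g i, hgK i⟩
  have hid : (inclusionHom K).comp φ = .id F :=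
    (hF F g).unique (fun i => congrArg Subtype.val (hφ i)) fun _ => rfl
  refine eq_top_iff.mpr fun x _ => ?_
  have hx : (φ x : F) = x := DFunLike.congr_fun hid x
  exact hx ▸ (φ x).2

end Generation

/-! ### Existence of the normal form -/

section Existence

open CompletedGroupAlgebra

/-- The index set of the normal form: the pairs `i < j`. -/
abbrev NormalFormIndex (d : ℕ) : Type := {ij : Fin d × Fin d // ij.1 < ij.2}

/-- The families `(r_ij)_{i<j}` with `r_ij ∈ R_j = ℤ_p[[X_j]]`. -/
abbrev NormalFormCoeffs (p : ℕ) [Fact p.Prime] {d : ℕ} {F : Type*} [Group F]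
    [TopologicalSpace F] [IsTopologicalGroup F] (g : Fin d → F) : Type _ :=
  (ij : NormalFormIndex d) → CompletedGroupAlgebra ℤ_[p] (closedSpan g ij.1.2)

section SpanAlgebra

variable (p : ℕ) [Fact p.Prime] {d : ℕ} {F : Type*} [Group F] [TopologicalSpace F]
  [IsTopologicalGroup F] (g : Fin d → F)

/-- The image of `R_j = ℤ_p[[X_j]]` in `ℤ_p[[X]]`. -/
def spanAlgebra (j : Fin d) :
    Subalgebra ℤ_[p] (CompletedGroupAlgebra ℤ_[p] (TopologicalAbelianization F)) :=
  (map ℤ_[p] (inclusionHom (closedSpan g j))).range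

variable {g} {i j : Fin d}

theorem mem_closedSpan (hij : i ≤ j) : (g i : TopologicalAbelianization F) ∈ closedSpan g j :=
  Subgroup.le_topologicalClosure _ (Subgroup.subset_closure ⟨i, hij, rfl⟩)

theorem closedSpan_mono (hij : i ≤ j) : closedSpan g i ≤ closedSpan g j :=
  Subgroup.topologicalClosure_mono
    (Subgroup.closure_mono (Set.image_mono (Set.Iic_subset_Iic.mpr hij)))

variable {p}

theorem of_mem_spanAlgebra {x : TopologicalAbelianization F} (hx : x ∈ closedSpan g j) :
    of ℤ_[p] x ∈ spanAlgebra p g j :=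
  ⟨of ℤ_[p] ⟨x, hx⟩, map_of _ _⟩

theorem of_sub_one_mem_spanAlgebra (hij : i ≤ j) :
    of ℤ_[p] (g i : TopologicalAbelianization F) - 1 ∈ spanAlgebra p g j :=
  sub_mem (of_mem_spanAlgebra (mem_closedSpan hij)) (one_mem _)

theorem spanAlgebra_mono (hij : i ≤ j) : spanAlgebra p g i ≤ spanAlgebra p g j := by
  rintro _ ⟨r, rfl⟩
  let f : closedSpan g i →ₜ* closedSpan g j :=
    { toMonoidHom := Subgroup.inclusion (closedSpan_mono hij)
      continuous_toFun := continuous_inclusion (closedSpan_mono hij) }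
  exact ⟨map ℤ_[p] f r, map_map f (inclusionHom (closedSpan g j)) r⟩

end SpanAlgebra

variable {p : ℕ} [Fact p.Prime] {F : Type*} [Group F] [TopologicalSpace F] [IsTopologicalGroup F]
  [CompactSpace F] [TotallyDisconnectedSpace F] [IsProP p F] [IsMetabelian F]

theorem closedDerived.of_smul (x : TopologicalAbelianization F) (a : Additive (closedDerived F)) :
    of ℤ_[p] x • a = Additive.ofMul (conjAction x a.toMul) :=
  closedDerived.ext_proj fun V => by
    rw [closedDerived.proj_smul]
    change (DerivedLevel.rep p V).asAlgebraHom (MonoidAlgebra.single _ 1) _ = _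
    rw [Representation.asAlgebraHom_single, one_smul]
    rfl

theorem closedDerived.coe_of_smul (f : F) (a : Additive (closedDerived F)) :
    ((of ℤ_[p] (f : TopologicalAbelianization F) • a).toMul : F) = f⁻¹ * (a.toMul : F) * f := by
  rw [closedDerived.of_smul]
  exact congrArg (f⁻¹ * (a.toMul : F) * ·) (inv_inv f)

variable {d : ℕ} {g : Fin d → F}

theorem basicCommutator_jacobi (i j k : Fin d) :
    (of ℤ_[p] (g k : TopologicalAbelianization F) - 1) • basicCommutator g i j =
      (of ℤ_[p] (g j : TopologicalAbelianization F) - 1) • basicCommutator g i k -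
        (of ℤ_[p] (g i : TopologicalAbelianization F) - 1) • basicCommutator g j k := by
  -- The two expansions of `[g_i g_j, g_k]`, written without subtraction.
  have expansions : of ℤ_[p] (g j : TopologicalAbelianization F) • basicCommutator g i k +
      basicCommutator g j k = -basicCommutator g i j +
        (of ℤ_[p] (g i : TopologicalAbelianization F) • basicCommutator g j k +
          basicCommutator g i k) +
        of ℤ_[p] (g k : TopologicalAbelianization F) • basicCommutator g i j := by
    apply Additive.toMul.injective
    apply Subtype.ext
    simp only [toMul_add, toMul_neg, Subgroup.coe_mul, closedDerived.coe_of_smul]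
    change _ * ((g j)⁻¹ * (g k)⁻¹ * g j * g k) = ((g i)⁻¹ * (g j)⁻¹ * g i * g j)⁻¹ * _ * _
    simp only [basicCommutator, toMul_ofMul]
    group
  simp only [sub_smul, one_smul]
  rw [← sub_eq_zero] at expansions ⊢
  rw [← neg_eq_zero, ← expansions]
  abel

variable (p g)

/-- The map `(r_ij) ↦ ∑ u_ij r_ij`. -/
def normalFormMap : NormalFormCoeffs p g →+ Additive (closedDerived F) where
  toFun r := ∑ ij : NormalFormIndex d,
    map ℤ_[p] (inclusionHom (closedSpan g ij.1.2)) (r ij) • basicCommutator g ij.1.1 ij.1.2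
  map_zero' := by simp
  map_add' r s := by simp [add_smul, Finset.sum_add_distrib]

theorem normalFormMap_apply (r : NormalFormCoeffs p g) :
    normalFormMap p g r = ∑ ij : NormalFormIndex d,
      map ℤ_[p] (inclusionHom (closedSpan g ij.1.2)) (r ij) • basicCommutator g ij.1.1 ij.1.2 :=
  rfl

variable {p g} {i j k : Fin d}
  {t w : CompletedGroupAlgebra ℤ_[p] (TopologicalAbelianization F)} {a : Additive (closedDerived F)}

theorem smul_basicCommutator_mem_range (hij : i < j) (ht : t ∈ spanAlgebra p g j) :
    t • basicCommutator g i j ∈ (normalFormMap p g).range := by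
  obtain ⟨r, rfl⟩ := ht
  refine ⟨Pi.single ⟨(i, j), hij⟩ r, ?_⟩
  rw [normalFormMap_apply, Fintype.sum_eq_single ⟨(i, j), hij⟩, Pi.single_eq_same]
  · rfl
  · intro _ hne
    rw [Pi.single_eq_of_ne hne, map_zero, zero_smul]

theorem mul_of_sub_one_smul_basicCommutator_mem_range (hij : i < j) (ht : t ∈ spanAlgebra p g j)
    (hw : w ∈ spanAlgebra p g k) :
    (w * (of ℤ_[p] (g k : TopologicalAbelianization F) - 1)) • t • basicCommutator g i j ∈
      (normalFormMap p g).range := by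
  rcases le_or_gt k j with hkj | hjk
  · rw [smul_smul]
    exact smul_basicCommutator_mem_range hij
      (mul_mem (mul_mem (spanAlgebra_mono hkj hw) (of_sub_one_mem_spanAlgebra hkj)) ht)
  · have hwt : w * t ∈ spanAlgebra p g k := mul_mem hw (spanAlgebra_mono hjk.le ht)
    rw [smul_smul, mul_assoc, CompletedGroupAlgebra.mul_comm (_ - 1) t, ← mul_assoc, mul_smul,
      basicCommutator_jacobi, smul_sub, smul_smul, smul_smul]
    exact sub_mem
      (smul_basicCommutator_mem_range (hij.trans hjk)
        (mul_mem hwt (of_sub_one_mem_spanAlgebra hjk.le)))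
      (smul_basicCommutator_mem_range hjk
        (mul_mem hwt (of_sub_one_mem_spanAlgebra (hij.trans hjk).le)))

theorem mul_of_sub_one_smul_mem_range (hw : w ∈ spanAlgebra p g k)
    (ha : a ∈ (normalFormMap p g).range) :
    (w * (of ℤ_[p] (g k : TopologicalAbelianization F) - 1)) • a ∈ (normalFormMap p g).range := by
  obtain ⟨r, rfl⟩ := ha
  rw [normalFormMap_apply, Finset.smul_sum]
  exact sum_mem fun ij _ => mul_of_sub_one_smul_basicCommutator_mem_range ij.2 ⟨r ij, rfl⟩ hw

theorem of_smul_mem_range (ha : a ∈ (normalFormMap p g).range) :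
    of ℤ_[p] (g k : TopologicalAbelianization F) • a ∈ (normalFormMap p g).range := by
  have hmem := add_mem ha (mul_of_sub_one_smul_mem_range (one_mem (spanAlgebra p g k)) ha)
  rwa [one_mul, sub_smul, one_smul, add_sub_cancel] at hmem

theorem of_inv_smul_mem_range (ha : a ∈ (normalFormMap p g).range) :
    of ℤ_[p] (g k : TopologicalAbelianization F)⁻¹ • a ∈ (normalFormMap p g).range := by
  have hinv : of ℤ_[p] (g k : TopologicalAbelianization F)⁻¹ ∈ spanAlgebra p g k :=
    of_mem_spanAlgebra (inv_mem (mem_closedSpan le_rfl))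
  have hmem := sub_mem ha (mul_of_sub_one_smul_mem_range hinv ha)
  rwa [mul_sub, ← map_mul, inv_mul_cancel, map_one, mul_one, sub_smul, one_smul,
    sub_sub_cancel] at hmem

section Closed

attribute [local instance] groupAlgebraTopology

theorem isClosed_range_normalFormMap :
    IsClosed ((normalFormMap p g).range : Set (Additive (closedDerived F))) := by
  have hspan (j : Fin d) : CompactSpace (closedSpan g j) :=
    isCompact_iff_compactSpace.mp (Subgroup.isClosed_topologicalClosure _).isCompact
  have hcoeffs (j : Fin d) : CompactSpace (CompletedGroupAlgebra ℤ_[p] (closedSpan g j)) :=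
    CompletedGroupAlgebra.compactSpace
  have hcont : Continuous (normalFormMap p g) := continuous_finsetSum _ fun ij _ =>
    (closedDerived.continuous_smul_left _ _).comp (continuous_apply ij)
  exact (isCompact_range hcont).isClosed

end Closed

theorem addSubgroup_eq_top_of_smul_mem
    (hg : (Subgroup.closure (Set.range g)).topologicalClosure = ⊤)
    {M : AddSubgroup (Additive (closedDerived F))}
    (hM : IsClosed (M : Set (Additive (closedDerived F))))
    (hsmul : ∀ k, ∀ a ∈ M, of ℤ_[p] (g k : TopologicalAbelianization F) • a ∈ M)
    (hsmul_inv : ∀ k, ∀ a ∈ M, of ℤ_[p] (g k : TopologicalAbelianization F)⁻¹ • a ∈ M)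
    (hcomm : ∀ i j, i < j → basicCommutator g i j ∈ M) : M = ⊤ := by
  let P : Subgroup F := (AddSubgroup.toSubgroup' M).map (closedDerived F).subtype
  have hP : IsClosed (P : Set F) :=
    (Subgroup.isClosed_topologicalClosure _).isClosedMap_subtype_val _ hM
  have mem_P {a : Additive (closedDerived F)} (ha : a ∈ M) : (a.toMul : F) ∈ P := ⟨a.toMul, ha, rfl⟩
  have hle : closedDerived F ≤ P := by
    refine Subgroup.topologicalClosure_minimal _
      (commutator_le_of_topologicalClosure_closure_eq_top hg hP ?_ ?_) hP
    · rintro _ ⟨k, rfl⟩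
      have conj_mem (x : F) (hx : x ∈ P) : (g k)⁻¹ * x * g k ∈ P := by
        obtain ⟨a, ha, rfl⟩ := hx
        exact closedDerived.coe_of_smul (p := p) (g k) (.ofMul a) ▸ mem_P (hsmul k _ ha)
      have conj_inv_mem (x : F) (hx : x ∈ P) : g k * x * (g k)⁻¹ ∈ P := by
        obtain ⟨a, ha, rfl⟩ := hx
        have := closedDerived.coe_of_smul (p := p) (g k)⁻¹ (.ofMul a)
        rw [inv_inv] at this
        exact this ▸ mem_P (hsmul_inv k _ ha)
      refine Subgroup.mem_normalizer_iff.mpr fun x => ⟨conj_inv_mem x, fun hx => ?_⟩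
      simpa [mul_assoc] using conj_mem _ hx
    · rintro _ ⟨i, rfl⟩ _ ⟨j, rfl⟩
      rcases lt_trichotomy i j with hij | rfl | hji
      · exact mem_P (hcomm i j hij)
      · simp
      · simpa [mul_assoc, basicCommutator] using P.inv_mem (mem_P (hcomm j i hji))
  refine eq_top_iff.mpr fun a _ => ?_
  obtain ⟨b, hb, hba⟩ := hle a.toMul.2
  obtain rfl : b = a.toMul := Subtype.ext hba
  exact hb

theorem normalFormMap_surjective
    (hg : (Subgroup.closure (Set.range g)).topologicalClosure = ⊤) :
    Function.Surjective (normalFormMap p g) :=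
  AddMonoidHom.range_eq_top.mp <| addSubgroup_eq_top_of_smul_mem (p := p) hg
    isClosed_range_normalFormMap (fun _ _ => of_smul_mem_range)
    (fun _ _ => of_inv_smul_mem_range) fun i j hij => by
      simpa using smul_basicCommutator_mem_range hij (one_mem (spanAlgebra p g j))

end Existence

/-! ### Translation-invariant elements of finite group algebras -/

section TranslationInvariant

theorem sum_eq_card_nsmul_sum_quotient {G M : Type*} [Group G] [Fintype G] [AddCommMonoid M]
    (T : Subgroup G) [Fintype (G ⧸ T)] {h : G → M} (hh : ∀ x, ∀ t ∈ T, h (x * t) = h x) :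
    ∑ x, h x = Nat.card T • ∑ q : G ⧸ T, h q.out := by
  have : Fintype T := Fintype.ofFinite T
  have h_out (x : G) : h x = h (x : G ⧸ T).out := by
    obtain ⟨t, ht⟩ := QuotientGroup.mk_out_eq_mul T x
    rw [ht, hh x t t.2]
  calc ∑ x, h x
    _ = ∑ x, h (T.groupEquivQuotientProdSubgroup x).1.out := Finset.sum_congr rfl fun x _ => h_out x
    _ = ∑ z : (G ⧸ T) × T, h z.1.out :=
      Equiv.sum_comp T.groupEquivQuotientProdSubgroup fun z : (G ⧸ T) × T => h z.1.out
    _ = Nat.card T • ∑ q : G ⧸ T, h q.out := by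
      simp [Fintype.sum_prod_type, Finset.smul_sum]

variable {k G : Type*} [CommRing k]

theorem mapDomain_eq_zero_of_coeff_mul_eq [Group G] [Finite G] {Q : Type*} (T : Subgroup G)
    (hT : (Nat.card T : k) = 0) {f : G → Q} (hf : ∀ x, ∀ t ∈ T, f (x * t) = f x)
    {s : MonoidAlgebra k G} (hs : ∀ x, ∀ t ∈ T, s.coeff (x * t) = s.coeff x) :
    MonoidAlgebra.mapDomain f s = 0 := by
  have : Fintype G := Fintype.ofFinite G
  have : Fintype (G ⧸ T) := Fintype.ofFinite (G ⧸ T)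
  have h_sum : MonoidAlgebra.mapDomain f s = ∑ x, MonoidAlgebra.single (f x) (s.coeff x) := by
    rw [← s.sum_coeff_single, MonoidAlgebra.mapDomain_sum, s.sum_coeff_single,
      Finsupp.sum_fintype _ _ (by simp)]
    simp only [MonoidAlgebra.mapDomain_single]
  rw [h_sum, sum_eq_card_nsmul_sum_quotient T fun x t ht => by rw [hs x t ht, hf x t ht],
    ← Nat.cast_smul_eq_nsmul k, hT, zero_smul]

theorem coeff_mul_eq_of_mem_zpowers [CommGroup G] [Finite G] {x : G} {s : MonoidAlgebra k G}
    (hs : (MonoidAlgebra.of k G x - 1) * s = 0) {t : G} (ht : t ∈ Subgroup.zpowers x) (y : G) :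
    s.coeff (y * t) = s.coeff y := by
  have hx : MonoidAlgebra.of k G x * s = s := by
    rwa [sub_mul, one_mul, sub_eq_zero] at hs
  have hpow (n : ℕ) : MonoidAlgebra.of k G (x ^ n) * s = s := by
    induction n with
    | zero => rw [pow_zero, map_one, one_mul]
    | succ n ih => rw [pow_succ, map_mul, mul_assoc, hx, ih]
  obtain ⟨n, rfl⟩ := (Submonoid.mem_powers_iff _ _).mp (mem_powers_iff_mem_zpowers.mpr ht)
  conv_lhs => rw [← hpow n]
  rw [MonoidAlgebra.of_apply, MonoidAlgebra.coeff_single_mul_eq_mul_coeff y fun z _ => by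
    rw [mul_comm, mul_left_inj], one_mul]

end TranslationInvariant

/-- The group `(ℤ/n)^ι`, written multiplicatively. -/
abbrev ZModTorus (ι : Type*) (n : ℕ) : Type _ := Multiplicative (ι → ZMod n)

namespace ZModTorus

variable {ι : Type*} {n : ℕ}

/-- The standard generators of `(ℤ/n)^ι`. -/
def basis [DecidableEq ι] (n : ℕ) (i : ι) : ZModTorus ι n := Multiplicative.ofAdd (Pi.single i 1)

theorem isPGroup {p : ℕ} (n : ℕ) : IsPGroup p (ZModTorus ι (p ^ n)) := fun y =>
  ⟨n, Multiplicative.toAdd.injective <| funext fun i => by simp [toAdd_pow]⟩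

/-- Reduction modulo a divisor `n` of `m`. -/
def reduction (ι : Type*) {n m : ℕ} (h : n ∣ m) : ZModTorus ι m →ₜ* ZModTorus ι n where
  toMonoidHom := ((ZMod.castHom h (ZMod n)).toAddMonoidHom.compLeft ι).toMultiplicative
  continuous_toFun :=
    continuous_pi fun i => (continuous_of_discreteTopology (f := ZMod.castHom h (ZMod n))).comp
      (continuous_apply (A := fun _ : ι => ZMod m) i)

variable [DecidableEq ι]

theorem reduction_basis {n m : ℕ} (h : n ∣ m) (i : ι) :
    reduction ι h (basis m i) = basis n i :=
  Multiplicative.toAdd.injective <| funext fun j => by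
    change ZMod.castHom h (ZMod n) ((Pi.single i 1 : ι → ZMod m) j) = _
    rw [Pi.single_apply]
    split_ifs <;> simp [basis, *]

theorem toAdd_prod_basis_zpow [Fintype ι] (a : ι → ℤ) (j : ι) :
    (∏ i, basis n i ^ a i).toAdd j = a j := by
  rw [toAdd_prod, Finset.sum_apply]
  simp [basis, Pi.single_apply]

theorem prod_basis_zpow_eq_one_iff [Fintype ι] {a : ι → ℤ} :
    ∏ i, basis n i ^ a i = 1 ↔ ∀ i, (n : ℤ) ∣ a i := by
  simp only [← ZMod.intCast_zmod_eq_zero_iff_dvd, ← toAdd_prod_basis_zpow (n := n) a]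
  exact (Multiplicative.toAdd (α := ι → ZMod n)).injective.eq_iff.symm.trans funext_iff

theorem orderOf_basis (n : ℕ) (i : ι) : orderOf (basis n i) = n :=
  (orderOf_ofAdd_eq_addOrderOf _).trans <|
    (addOrderOf_injective (AddMonoidHom.single (fun _ : ι => ZMod n) i)
      (Pi.single_injective (M := fun _ : ι => ZMod n) i) 1).trans (ZMod.addOrderOf_one n)

theorem mapDomain_reduction_eq_zero [Finite ι] {n l : ℕ} [NeZero n] [NeZero l] (i : ι)
    {s : MonoidAlgebra (ZMod l) (ZModTorus ι (n * l))}
    (hs : (MonoidAlgebra.of (ZMod l) _ (basis (n * l) i) - 1) * s = 0) :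
    MonoidAlgebra.mapDomain (reduction ι (dvd_mul_right n l)) s = 0 := by
  have hcard : Nat.card (Subgroup.zpowers (basis (n * l) i ^ n)) = l := by
    rw [Nat.card_zpowers, orderOf_pow_of_dvd (NeZero.ne n), orderOf_basis,
      Nat.mul_div_cancel_left l (NeZero.pos n)]
    rw [orderOf_basis]
    exact dvd_mul_right n l
  have : NeZero (n * l) := ⟨mul_ne_zero (NeZero.ne n) (NeZero.ne l)⟩
  have : Finite (ZModTorus ι (n * l)) := inferInstanceAs (Finite (ι → ZMod (n * l)))
  refine mapDomain_eq_zero_of_coeff_mul_eq (Subgroup.zpowers (basis (n * l) i ^ n))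
    (by simp [hcard]) (fun x t ht => ?_) fun x t ht =>
      coeff_mul_eq_of_mem_zpowers hs (Subgroup.zpowers_le.mpr (Subgroup.npow_mem_zpowers _ n) ht) x
  obtain ⟨a, rfl⟩ := Subgroup.mem_zpowers_iff.mp ht
  have hpow : basis n i ^ n = 1 := by
    rw [← orderOf_dvd_iff_pow_eq_one, orderOf_basis]
  rw [map_mul, map_zpow, map_pow, reduction_basis, hpow, one_zpow, mul_one]

end ZModTorus

theorem lift_of_eq_mapRingHom {k A G : Type*} [CommRing k] [CommRing A] [Algebra k A] [Monoid G]
    (s : MonoidAlgebra k G) :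
    MonoidAlgebra.lift k (MonoidAlgebra A G) G (MonoidAlgebra.of A G) s =
      MonoidAlgebra.mapRingHom G (algebraMap k A) s := by
  rw [← MonoidAlgebra.lift_mapRingHom_algebraMap (S := A)]
  exact (DFunLike.congr_fun (MonoidAlgebra.lift_unique' (AlgHom.id A (MonoidAlgebra A G))) _).symm

theorem eq_zero_of_forall_mapRingHom_toZModPow_eq_zero {p : ℕ} [Fact p.Prime] {G : Type*}
    [Monoid G] {s : MonoidAlgebra ℤ_[p] G}
    (hs : ∀ l, MonoidAlgebra.mapRingHom G (PadicInt.toZModPow l) s = 0) : s = 0 := by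
  refine MonoidAlgebra.coeff_injective (Finsupp.ext fun x => PadicInt.ext_of_toZModPow.mp
    fun l => ?_)
  have hx := congrArg (fun t => t.coeff x) (hs l)
  simpa using hx

/-! ### The Magnus representation -/

/-- The group of matrices `(y, 0; b, 1)`, where `y ∈ Y` is viewed as an element of `B` by means of
a homomorphism `χ`, with the discrete topology. -/
@[ext]
structure MagnusGroup {Y B : Type*} [CommGroup Y] [CommRing B] (χ : Y →* B) where
  y : Y
  b : B

namespace MagnusGroup

variable {Y B : Type*} [CommGroup Y] [CommRing B] {χ : Y →* B}

theorem map_mul_map_inv (χ : Y →* B) (y : Y) : χ y * χ y⁻¹ = 1 := by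
  rw [← map_mul, mul_inv_cancel, map_one]

instance : Mul (MagnusGroup χ) := ⟨fun g h => ⟨g.y * h.y, χ h.y * g.b + h.b⟩⟩
instance : One (MagnusGroup χ) := ⟨⟨1, 0⟩⟩
instance : Inv (MagnusGroup χ) := ⟨fun g => ⟨g.y⁻¹, -(χ g.y⁻¹ * g.b)⟩⟩

@[simp] theorem mul_y (g h : MagnusGroup χ) : (g * h).y = g.y * h.y := rfl
@[simp] theorem mul_b (g h : MagnusGroup χ) : (g * h).b = χ h.y * g.b + h.b := rfl
@[simp] theorem one_y : (1 : MagnusGroup χ).y = 1 := rfl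
@[simp] theorem one_b : (1 : MagnusGroup χ).b = 0 := rfl
@[simp] theorem inv_y (g : MagnusGroup χ) : g⁻¹.y = g.y⁻¹ := rfl
@[simp] theorem inv_b (g : MagnusGroup χ) : g⁻¹.b = -(χ g.y⁻¹ * g.b) := rfl

instance : Group (MagnusGroup χ) where
  mul_assoc g h k := by
    ext
    · exact mul_assoc _ _ _
    · simp only [mul_b, mul_y, map_mul]
      ring
  one_mul g := by ext <;> simp
  mul_one g := by ext <;> simp
  inv_mul_cancel g := by
    ext
    · exact inv_mul_cancel _
    · simp only [mul_b, inv_b, one_b]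
      linear_combination (-g.b) * map_mul_map_inv χ g.y

instance : TopologicalSpace (MagnusGroup χ) := ⊥
instance : DiscreteTopology (MagnusGroup χ) := ⟨rfl⟩

/-- The projection of the Magnus group to `Y`. -/
def toY [TopologicalSpace Y] (χ : Y →* B) : MagnusGroup χ →ₜ* Y where
  toFun := y
  map_one' := rfl
  map_mul' _ _ := rfl
  continuous_toFun := continuous_of_discreteTopology

theorem conj_b (g : MagnusGroup χ) {h : MagnusGroup χ} (hh : h.y = 1) :
    (g⁻¹ * h * g).b = χ g.y * h.b := by
  simp only [mul_b, inv_b, hh, map_one]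
  linear_combination (-g.b) * map_mul_map_inv χ g.y

theorem commutator_b (g h : MagnusGroup χ) :
    (g⁻¹ * h⁻¹ * g * h).b = (χ h.y - 1) * g.b - (χ g.y - 1) * h.b := by
  simp only [mul_b, inv_b, inv_y]
  linear_combination (-g.b * χ h.y * χ h.y⁻¹) * map_mul_map_inv χ g.y -
    (g.b + χ g.y * h.b) * map_mul_map_inv χ h.y

instance [Finite Y] [Finite B] : Finite (MagnusGroup χ) :=
  Finite.of_injective (fun g : MagnusGroup χ => (g.y, g.b)) fun _ _ h =>
    MagnusGroup.ext (congrArg Prod.fst h) (congrArg Prod.snd h)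

theorem y_eq_one_of_mem_closedDerived {F : Type*} [Group F] [TopologicalSpace F]
    [IsTopologicalGroup F] (φ : F →ₜ* MagnusGroup χ) {a : F} (ha : a ∈ closedDerived F) :
    (φ a).y = 1 := by
  let _ : TopologicalSpace Y := ⊥
  have : DiscreteTopology Y := ⟨rfl⟩
  exact Subgroup.topologicalClosure_minimal _
    (Abelianization.commutator_subset_ker ((toY χ).comp φ : F →* Y))
    (isClosed_singleton.preimage ((toY χ).comp φ).continuous_toFun) ha

instance : IsMetabelian (MagnusGroup χ) := ⟨by
  have y_eq_one {g : MagnusGroup χ} (hg : g ∈ commutator (MagnusGroup χ)) : g.y = 1 :=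
    y_eq_one_of_mem_closedDerived (.id _) (Subgroup.le_topologicalClosure _ hg)
  rw [derivedSeries_succ, derivedSeries_one, eq_bot_iff, Subgroup.commutator_le]
  intro g hg h hh
  rw [Subgroup.mem_bot, commutatorElement_eq_one_iff_mul_comm]
  ext
  · exact mul_comm _ _
  · simp only [mul_b, y_eq_one hg, y_eq_one hh, map_one, one_mul, add_comm]⟩

theorem pow_y (g : MagnusGroup χ) (n : ℕ) : (g ^ n).y = g.y ^ n := by
  induction n with
  | zero => simp
  | succ n ih => rw [pow_succ, mul_y, ih, pow_succ]

theorem pow_b {g : MagnusGroup χ} (hg : g.y = 1) (n : ℕ) : (g ^ n).b = n • g.b := by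
  induction n with
  | zero => simp
  | succ n ih => rw [pow_succ, mul_b, ih, hg, map_one, one_mul, succ_nsmul]

theorem isPGroup {p l : ℕ} (hY : IsPGroup p Y) (hB : ∀ b : B, p ^ l • b = 0) :
    IsPGroup p (MagnusGroup χ) := by
  intro g
  obtain ⟨n, hn⟩ := hY g.y
  have hy : (g ^ p ^ n).y = 1 := by rw [pow_y, hn]
  refine ⟨n + l, ?_⟩
  rw [pow_add, pow_mul]
  ext
  · rw [pow_y, hy, one_pow, one_y]
  · rw [pow_b hy, hB, one_b]

end MagnusGroup

theorem IsFreeMetabelianProP.exists_hom {p : ℕ} {ι : Type*} {F : Type u} [Group F]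
    [TopologicalSpace F] {g : ι → F} (hF : IsFreeMetabelianProP p g) {H : Type} [Group H]
    [TopologicalSpace H] [DiscreteTopology H] [Finite H] [IsMetabelian H] (hH : IsPGroup p H)
    (h : ι → H) : ∃ φ : F →ₜ* H, ∀ i, φ (g i) = h i := by
  let e : ULift.{u} H ≃* H := MulEquiv.ulift
  have : IsMetabelian (ULift.{u} H) := .of_injective e.toMonoidHom e.injective
  have : IsProP p (ULift.{u} H) := ⟨fun N =>
    (hH.of_injective e.toMonoidHom e.injective).to_quotient N.toSubgroup⟩
  obtain ⟨φ, hφ, -⟩ := hF (ULift.{u} H) fun i => e.symm (h i)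
  let e' : ULift.{u} H →ₜ* H := ⟨e.toMonoidHom, continuous_uliftDown⟩
  exact ⟨e'.comp φ, fun i => congrArg e (hφ i)⟩

/-- The homomorphism from `F/F'` to an abelian group induced by one from `F`. -/
def abelianizationLift {F Y : Type*} [Group F] [TopologicalSpace F] [IsTopologicalGroup F]
    [CommGroup Y] [TopologicalSpace Y] [T1Space Y] (θ : F →ₜ* Y) :
    TopologicalAbelianization F →ₜ* Y where
  toMonoidHom := QuotientGroup.lift (closedDerived F) (θ : F →* Y)
    (Subgroup.topologicalClosure_minimal _ (Abelianization.commutator_subset_ker (θ : F →* Y))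
      (isClosed_singleton.preimage θ.continuous_toFun))
  continuous_toFun := θ.continuous_toFun.quotient_lift _

theorem IsFreeMetabelianProP.exists_abelianization_hom {p : ℕ} {ι : Type*} {F : Type u} [Group F]
    [TopologicalSpace F] [IsTopologicalGroup F] {g : ι → F} (hF : IsFreeMetabelianProP p g)
    {Y : Type} [CommGroup Y] [TopologicalSpace Y] [DiscreteTopology Y] [Finite Y]
    (hY : IsPGroup p Y) (y : ι → Y) :
    ∃ ψ : TopologicalAbelianization F →ₜ* Y, ∀ i, ψ (g i) = y i := by
  have : IsMetabelian Y := ⟨by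
    rw [derivedSeries_succ, derivedSeries_one, Subgroup.commutator_eq_bot_iff_le_centralizer]
    exact fun x _ z _ => mul_comm z x⟩
  obtain ⟨θ, hθ⟩ := hF.exists_hom hY y
  exact ⟨abelianizationLift θ, hθ⟩

theorem comp_inclusionHom_closedSpan_congr {F Y : Type*} [Group F] [TopologicalSpace F]
    [IsTopologicalGroup F] [Group Y] [TopologicalSpace Y] [T2Space Y] {d : ℕ} {g : Fin d → F}
    {j : Fin d} {ψ ψ' : TopologicalAbelianization F →ₜ* Y} (h : ∀ i ≤ j, ψ (g i) = ψ' (g i)) :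
    ψ.comp (inclusionHom (closedSpan g j)) = ψ'.comp (inclusionHom (closedSpan g j)) := by
  have hle : closedSpan g j ≤
      (ψ : TopologicalAbelianization F →* Y).eqLocus (ψ' : TopologicalAbelianization F →* Y) := by
    refine Subgroup.topologicalClosure_minimal _ ((Subgroup.closure_le _).mpr ?_)
      (isClosed_eq ψ.continuous_toFun ψ'.continuous_toFun)
    rintro _ ⟨i, hi, rfl⟩
    exact h i hi
  exact ContinuousMonoidHom.ext fun x => hle x.2

section Magnus

open CompletedGroupAlgebra

variable {p : ℕ} [Fact p.Prime] {Y B : Type*} [CommGroup Y] [TopologicalSpace Y]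
  [DiscreteTopology Y] [CommRing B] {χ : Y →* B}

namespace MagnusGroup

/-- The restriction to `F'`, written additively, of a homomorphism from `F` to a Magnus group. -/
def derivedHom {F : Type*} [Group F] [TopologicalSpace F] [IsTopologicalGroup F]
    (φ : F →ₜ* MagnusGroup χ) : Additive (closedDerived F) →+ B where
  toFun a := (φ a.toMul).b
  map_zero' := by simp
  map_add' a c := by simp [y_eq_one_of_mem_closedDerived φ (Subtype.prop _)]

variable {F : Type*} [Group F] [TopologicalSpace F] [IsTopologicalGroup F]
  [CompactSpace F] [TotallyDisconnectedSpace F] [IsProP p F] [IsMetabelian F]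
  [Algebra ℤ_[p] B]

theorem derivedHom_smul (φ : F →ₜ* MagnusGroup χ)
    (r : CompletedGroupAlgebra ℤ_[p] (TopologicalAbelianization F))
    (a : Additive (closedDerived F)) :
    derivedHom φ (r • a) =
      MonoidAlgebra.lift ℤ_[p] B Y χ
        (toGroupAlgebra ℤ_[p] (abelianizationLift ((toY χ).comp φ)) r) * derivedHom φ a := by
  set V := openKer φ
  have hker (x : F) (hx : x ∈ V.toSubgroup) : φ x = 1 := hx
  let φV : Additive (DerivedLevel V) →+ B := MonoidHom.toAdditiveLeft <|
    QuotientGroup.lift _ (AddMonoidHom.toMultiplicativeRight (derivedHom φ)) fun c hc => by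
      change (φ c).b = 0
      rw [hker c hc, one_b]
  have hφV (c) : φV (DerivedLevel.proj V c) = derivedHom φ c := rfl
  rw [← hφV, closedDerived.proj_smul, toGroupAlgebra_eq_of_le _ V.imageAb (by
    rintro _ ⟨f, hf, rfl⟩
    exact congrArg MagnusGroup.y (hker f hf))]
  change φV ((DerivedLevel.rep p V).asAlgebraHom (r.1 V.imageAb) _) = _
  generalize r.1 V.imageAb = s
  induction s using MonoidAlgebra.induction_linear with
  | zero => simp
  | add s t hs ht =>
    simp only [map_add, LinearMap.add_apply, MonoidAlgebra.mapDomain_add, hs, ht, add_mul]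
  | single x c =>
    obtain ⟨x, rfl⟩ := QuotientGroup.mk_surjective x
    obtain ⟨f, rfl⟩ := QuotientGroup.mk_surjective x
    rw [Representation.asAlgebraHom_single, LinearMap.smul_apply, DerivedLevel.map_padic_smul,
      MonoidAlgebra.mapDomain_single, MonoidAlgebra.lift_single, smul_mul_assoc]
    congr 1
    change (φ (f⁻¹ * (a.toMul : F) * f⁻¹⁻¹)).b = χ (φ f).y * (φ (a.toMul : F)).b
    rw [inv_inv, map_mul, map_mul, map_inv, conj_b _ (y_eq_one_of_mem_closedDerived φ a.toMul.2)]

theorem derivedHom_normalFormMap (φ : F →ₜ* MagnusGroup χ) {d : ℕ} {g : Fin d → F}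
    (r : NormalFormCoeffs p g) :
    derivedHom φ (normalFormMap p g r) =
      ∑ ij : NormalFormIndex d,
        MonoidAlgebra.lift ℤ_[p] B Y χ (toGroupAlgebra ℤ_[p]
          ((abelianizationLift ((toY χ).comp φ)).comp (inclusionHom (closedSpan g ij.1.2)))
            (r ij)) *
          ((χ (φ (g ij.1.2)).y - 1) * (φ (g ij.1.1)).b -
            (χ (φ (g ij.1.1)).y - 1) * (φ (g ij.1.2)).b) := by
  rw [normalFormMap_apply, map_sum]
  refine Finset.sum_congr rfl fun ij _ => ?_
  rw [derivedHom_smul, toGroupAlgebra_map, ← commutator_b]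
  simp only [← map_inv, ← map_mul]
  rfl

end MagnusGroup

end Magnus

section MagnusRelations

open CompletedGroupAlgebra

variable {p : ℕ} [Fact p.Prime] {F : Type u} [Group F] [TopologicalSpace F] [IsTopologicalGroup F]
  [CompactSpace F] [TotallyDisconnectedSpace F] [IsProP p F] [IsMetabelian F]
  {Y B : Type} [CommGroup Y] [TopologicalSpace Y] [DiscreteTopology Y] [Finite Y] [CommRing B]
  [Finite B] [Algebra ℤ_[p] B] {d : ℕ} {g : Fin d → F} {r : NormalFormCoeffs p g}

theorem IsFreeMetabelianProP.sum_lift_mul_eq_zero (hF : IsFreeMetabelianProP p g)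
    (hY : IsPGroup p Y) {l : ℕ} (hB : ∀ b : B, p ^ l • b = 0) (hr : normalFormMap p g r = 0)
    (χ : Y →* B) (ψ : TopologicalAbelianization F →ₜ* Y) (b : Fin d → B) :
    ∑ ij : NormalFormIndex d,
      MonoidAlgebra.lift ℤ_[p] B Y χ
        (toGroupAlgebra ℤ_[p] (ψ.comp (inclusionHom (closedSpan g ij.1.2))) (r ij)) *
      ((χ (ψ (g ij.1.2)) - 1) * b ij.1.1 - (χ (ψ (g ij.1.1)) - 1) * b ij.1.2) = 0 := by
  obtain ⟨φ, hφ⟩ := hF.exists_hom (MagnusGroup.isPGroup (χ := χ) hY hB)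
    fun i => ⟨ψ (g i), b i⟩
  have hψ (j : Fin d) : (abelianizationLift ((MagnusGroup.toY χ).comp φ)).comp
      (inclusionHom (closedSpan g j)) = ψ.comp (inclusionHom (closedSpan g j)) :=
    comp_inclusionHom_closedSpan_congr fun i _ => congrArg MagnusGroup.y (hφ i)
  have hsum := MagnusGroup.derivedHom_normalFormMap φ r
  simp only [hr, map_zero, hψ, hφ] at hsum
  exact hsum.symm

theorem IsFreeMetabelianProP.sub_one_mul_lift_eq_zero (hF : IsFreeMetabelianProP p g)
    (hY : IsPGroup p Y) {l : ℕ} (hB : ∀ b : B, p ^ l • b = 0) (hr : normalFormMap p g r = 0)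
    (χ : Y →* B) (ψ : TopologicalAbelianization F →ₜ* Y) {k m : Fin d} (hkm : k < m)
    (hm : ∀ ij : NormalFormIndex d, m < ij.1.2 → r ij = 0) :
    (χ (ψ (g m)) - 1) * MonoidAlgebra.lift ℤ_[p] B Y χ
      (toGroupAlgebra ℤ_[p] (ψ.comp (inclusionHom (closedSpan g m))) (r ⟨(k, m), hkm⟩)) = 0 := by
  -- Changing `ψ (g m)` to `1` only affects the terms with `j = m`; `b` kills those with `i ≠ k`.
  let b : Fin d → B := Pi.single k 1
  obtain ⟨ψ', hψ'⟩ := hF.exists_abelianization_hom hY (Function.update (fun i => ψ (g i)) m 1)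
  have hψ'_of_ne {i : Fin d} (hi : i ≠ m) : ψ' (g i) = ψ (g i) := by
    rw [hψ', Function.update_of_ne hi]
  have hψ'_m : ψ' (g m) = 1 := by rw [hψ', Function.update_self]
  have hdiff := sub_eq_zero.mpr ((hF.sum_lift_mul_eq_zero hY hB hr χ ψ b).trans
    (hF.sum_lift_mul_eq_zero hY hB hr χ ψ' b).symm)
  rw [← Finset.sum_sub_distrib, Fintype.sum_eq_single ⟨(k, m), hkm⟩] at hdiff
  · simpa [b, hψ'_m, hkm.ne', mul_comm] using hdiff
  rintro ⟨⟨i, j⟩, hij : i < j⟩ hne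
  rcases lt_trichotomy j m with hjm | rfl | hmj
  · have hψ'_j := comp_inclusionHom_closedSpan_congr (j := j) (ψ := ψ') (ψ' := ψ)
      fun a ha => hψ'_of_ne (ha.trans_lt hjm).ne
    rw [hψ'_j, hψ'_of_ne hjm.ne, hψ'_of_ne (hij.trans hjm).ne, sub_self]
  · have hik : i ≠ k := by
      rintro rfl
      exact hne rfl
    simp [b, hik, hkm.ne']
  · simp [hm ⟨(i, j), hij⟩ hmj]

end MagnusRelations

/-! ### Uniqueness of the normal form -/

section Uniqueness

open CompletedGroupAlgebra

theorem mem_of_map_eq_one_of_forall_pow_mem {G ι : Type*} [CommGroup G] [TopologicalSpace G]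
    [IsTopologicalGroup G] [Finite ι] [DecidableEq ι] {n : ℕ} {x : ι → G}
    {ψ : G →ₜ* ZModTorus ι n} (hψ : ∀ i, ψ (x i) = ZModTorus.basis n i) {U : OpenSubgroup G}
    (hU : ∀ w : G, w ^ n ∈ U) {z : G} (hz : z ∈ (Subgroup.closure (Set.range x)).topologicalClosure)
    (hψz : ψ z = 1) : z ∈ U := by
  have := Fintype.ofFinite ι
  obtain ⟨w, ⟨hwU, hψw⟩, hw⟩ := mem_closure_iff.mp hz
    ((fun w => w⁻¹ * z) ⁻¹' ((U : Set G) ∩ ψ ⁻¹' {1}))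
    ((U.isOpen.inter ((isOpen_discrete {1}).preimage ψ.continuous_toFun)).preimage (by fun_prop))
    (by simp [one_mem])
  replace hψw : ψ w = 1 := by
    have hinv : ψ (w⁻¹ * z) = 1 := hψw
    rwa [map_mul, map_inv, hψz, mul_one, inv_eq_one] at hinv
  obtain ⟨a, rfl⟩ := Subgroup.exists_of_mem_closure_range x w hw
  simp only [map_prod, map_zpow, hψ, ZModTorus.prod_basis_zpow_eq_one_iff] at hψw
  choose b hb using hψw
  have hpow : ∏ i, x i ^ a i = (∏ i, x i ^ b i) ^ n := by
    simp only [hb, ← Finset.prod_pow, mul_comm (n : ℤ), zpow_mul, zpow_natCast]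
  rw [← mul_inv_cancel_left (∏ i, x i ^ a i) z]
  exact mul_mem (hpow ▸ hU _) hwU

theorem exists_forall_openKer_le {p : ℕ} [Fact p.Prime] {F : Type*} [Group F]
    [TopologicalSpace F] [IsTopologicalGroup F] [CompactSpace F] [TotallyDisconnectedSpace F]
    [IsProP p F] {d : ℕ} {g : Fin d → F} {j : Fin d} (N : OpenNormalSubgroup (closedSpan g j)) :
    ∃ n, ∀ ψ : TopologicalAbelianization F →ₜ* ZModTorus (Fin d) (p ^ n),
      (∀ i, ψ (g i) = ZModTorus.basis (p ^ n) i) →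
        (openKer (ψ.comp (inclusionHom (closedSpan g j)))).toSubgroup ≤ N.toSubgroup := by
  obtain ⟨U, hU, hUN⟩ := isOpen_induced_iff.mp N.isOpen'
  have h_one : (1 : closedSpan g j) ∈ Subtype.val ⁻¹' U := hUN ▸ N.one_mem
  obtain ⟨V, hVU⟩ := ProfiniteGrp.exist_openNormalSubgroup_sub_open_nhds_of_one
    (hU.preimage (QuotientGroup.continuous_mk (N := closedDerived F))) h_one
  obtain ⟨n, hn⟩ := IsProP.exists_forall_pow_mem (p := p) V
  refine ⟨n, fun ψ hψ z hψz => ?_⟩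
  have hpow (w : TopologicalAbelianization F) : w ^ p ^ n ∈ V.imageAb.toOpenSubgroup := by
    obtain ⟨f, rfl⟩ := QuotientGroup.mk_surjective w
    exact ⟨f ^ p ^ n, hn f, rfl⟩
  obtain ⟨v, hv, hvz⟩ := mem_of_map_eq_one_of_forall_pow_mem hψ hpow
    (Subgroup.topologicalClosure_mono (Subgroup.closure_mono (Set.image_subset_range _ _)) z.2) hψz
  have hzU : z ∈ Subtype.val ⁻¹' U := by
    change (z : TopologicalAbelianization F) ∈ U
    exact hvz ▸ hVU hv
  rwa [hUN] at hzU

variable {p : ℕ} [Fact p.Prime] {F : Type u} [Group F] [TopologicalSpace F] [IsTopologicalGroup F]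
  [CompactSpace F] [TotallyDisconnectedSpace F] [IsProP p F] [IsMetabelian F]
  {d : ℕ} {g : Fin d → F}

namespace IsFreeMetabelianProP

theorem of_sub_one_mul_mapRingHom_eq_zero (hF : IsFreeMetabelianProP p g)
    {r : NormalFormCoeffs p g} (hr : normalFormMap p g r = 0) {k m : Fin d} (hkm : k < m)
    (hm : ∀ ij : NormalFormIndex d, m < ij.1.2 → r ij = 0) {Y : Type} [CommGroup Y]
    [TopologicalSpace Y] [DiscreteTopology Y] [Finite Y] (hY : IsPGroup p Y)
    (ψ : TopologicalAbelianization F →ₜ* Y) (l : ℕ) :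
    (MonoidAlgebra.of (ZMod (p ^ l)) Y (ψ (g m)) - 1) *
      MonoidAlgebra.mapRingHom Y (PadicInt.toZModPow l)
        (toGroupAlgebra ℤ_[p] (ψ.comp (inclusionHom (closedSpan g m))) (r ⟨(k, m), hkm⟩)) = 0 := by
  let _ : Algebra ℤ_[p] (ZMod (p ^ l)) := (PadicInt.toZModPow l).toAlgebra
  have : NeZero (p ^ l) := ⟨pow_ne_zero l (NeZero.ne p)⟩
  have : Finite (MonoidAlgebra (ZMod (p ^ l)) Y) :=
    .of_equiv _ (Finsupp.equivFunOnFinite.symm.trans MonoidAlgebra.coeffEquiv.symm)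
  have hB (b : MonoidAlgebra (ZMod (p ^ l)) Y) : p ^ l • b = 0 := by
    rw [← Nat.cast_smul_eq_nsmul (ZMod (p ^ l)), ZMod.natCast_self, zero_smul]
  rw [← RingHom.algebraMap_toAlgebra (PadicInt.toZModPow (p := p) l), ← lift_of_eq_mapRingHom]
  exact hF.sub_one_mul_lift_eq_zero hY hB hr (MonoidAlgebra.of (ZMod (p ^ l)) Y) ψ hkm hm

theorem toGroupAlgebra_eq_zero (hF : IsFreeMetabelianProP p g) {r : NormalFormCoeffs p g}
    (hr : normalFormMap p g r = 0) {k m : Fin d} (hkm : k < m)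
    (hm : ∀ ij : NormalFormIndex d, m < ij.1.2 → r ij = 0) {n : ℕ}
    {ψ : TopologicalAbelianization F →ₜ* ZModTorus (Fin d) (p ^ n)}
    (hψ : ∀ i, ψ (g i) = ZModTorus.basis (p ^ n) i) :
    toGroupAlgebra ℤ_[p] (ψ.comp (inclusionHom (closedSpan g m))) (r ⟨(k, m), hkm⟩) = 0 := by
  refine eq_zero_of_forall_mapRingHom_toZModPow_eq_zero fun l => ?_
  have h_ne (n : ℕ) : NeZero (p ^ n) := ⟨pow_ne_zero n (NeZero.ne p)⟩
  have : NeZero (p ^ n * p ^ l) := ⟨mul_ne_zero (NeZero.ne _) (NeZero.ne _)⟩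
  have : Finite (ZModTorus (Fin d) (p ^ n * p ^ l)) :=
    inferInstanceAs (Finite (Fin d → ZMod (p ^ n * p ^ l)))
  have hY : IsPGroup p (ZModTorus (Fin d) (p ^ n * p ^ l)) := by
    rw [← pow_add]
    exact ZModTorus.isPGroup (n + l)
  obtain ⟨ψ', hψ'⟩ := hF.exists_abelianization_hom hY (ZModTorus.basis (p ^ n * p ^ l))
  let π := ZModTorus.reduction (Fin d) (dvd_mul_right (p ^ n) (p ^ l))
  let incl := inclusionHom (closedSpan g m)
  have hψ_eq : ψ.comp incl = π.comp (ψ'.comp incl) :=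
    comp_inclusionHom_closedSpan_congr (ψ' := π.comp ψ') fun i _ => by
      rw [hψ, ← ZModTorus.reduction_basis (dvd_mul_right (p ^ n) (p ^ l)), ← hψ' i]
      rfl
  have hred := ZModTorus.mapDomain_reduction_eq_zero m
    (hψ' m ▸ hF.of_sub_one_mul_mapRingHom_eq_zero hr hkm hm hY ψ' l)
  have hcomm := RingHom.congr_fun (MonoidAlgebra.mapRingHom_comp_mapDomainRingHom
    (PadicInt.toZModPow (p := p) l) (π : _ →* ZModTorus (Fin d) (p ^ n)))
      (toGroupAlgebra ℤ_[p] (ψ'.comp incl) (r ⟨(k, m), hkm⟩))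
  rw [hψ_eq, ← mapDomain_toGroupAlgebra]
  exact hcomm.trans hred

theorem coeff_eq_zero_of_forall_lt (hF : IsFreeMetabelianProP p g) {r : NormalFormCoeffs p g}
    (hr : normalFormMap p g r = 0) {k m : Fin d} (hkm : k < m)
    (hm : ∀ ij : NormalFormIndex d, m < ij.1.2 → r ij = 0) : r ⟨(k, m), hkm⟩ = 0 := by
  refine ext_val fun N => ?_
  obtain ⟨n, hn⟩ := exists_forall_openKer_le (p := p) N
  have hY : IsPGroup p (ZModTorus (Fin d) (p ^ n)) := ZModTorus.isPGroup n
  have : NeZero (p ^ n) := ⟨pow_ne_zero n (NeZero.ne p)⟩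
  have : Finite (ZModTorus (Fin d) (p ^ n)) := inferInstanceAs (Finite (Fin d → ZMod (p ^ n)))
  obtain ⟨ψ, hψ⟩ := hF.exists_abelianization_hom hY (ZModTorus.basis (p ^ n))
  exact val_eq_zero_of_toGroupAlgebra_eq_zero (hn ψ hψ) (hF.toGroupAlgebra_eq_zero hr hkm hm hψ)

theorem normalFormMap_injective (hF : IsFreeMetabelianProP p g) :
    Function.Injective (normalFormMap p g) := by
  refine (injective_iff_map_eq_zero _).mpr fun r hr => funext ?_
  suffices h : ∀ m k : Fin d, ∀ hkm : k < m, r ⟨(k, m), hkm⟩ = 0 from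
    fun ij => h ij.1.2 ij.1.1 ij.2
  intro m
  induction m using WellFoundedGT.induction with
  | ind m ih =>
    exact fun k hkm => hF.coeff_eq_zero_of_forall_lt hr hkm fun ij hij => ih ij.1.2 hij ij.1.1 ij.2

end IsFreeMetabelianProP

end Uniqueness

end

/-- Each element of `A = F'` is uniquely of the form `∑_{i<j} u_ij r_ij` with
`r_ij ∈ R_j = ℤ_p[[X_j]]`. -/
theorem mainTheorem4 (p : ℕ) [Fact p.Prime] (d : ℕ) (hd : 2 ≤ d)
    (F : Type u) [Group F] [TopologicalSpace F] [IsTopologicalGroup F] [CompactSpace F]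
    [TotallyDisconnectedSpace F] [IsProP p F] [IsMetabelian F]
    (g : Fin d → F) (hF : IsFreeMetabelianProP p g) (a : Additive (closedDerived F)) :
    ∃! r : (ij : {ij : Fin d × Fin d // ij.1 < ij.2}) →
        CompletedGroupAlgebra ℤ_[p] (closedSpan g ij.1.2),
      a = ∑ ij : {ij : Fin d × Fin d // ij.1 < ij.2},
        CompletedGroupAlgebra.map ℤ_[p] (inclusionHom (closedSpan g ij.1.2)) (r ij) •
          basicCommutator g ij.1.1 ij.1.2 := by
  obtain ⟨r, hr⟩ := normalFormMap_surjective (p := p) hF.topologicalClosure_closure_eq_top a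
  exact ⟨r, hr.symm, fun s hs => hF.normalFormMap_injective (hs.symm.trans hr.symm)⟩
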